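/- Let $N\ge 1$, $0<\theta\le 2$ and $0<\gamma<\min\{\theta,N\}$; if $\theta<2$, assume also $\gamma<\theta(p-1)$. Let $p>p_\gamma:=1+\frac{\theta-\gamma}{N}$. Let $G(x,t)=(2\pi)^{-N}\int_{\mathbf R^N}e^{ix\cdot\xi-t|\xi|^\theta}\,d\xi$ be the fundamental solution of $\partial_t v+(-\Delta)^{\theta/2}v=0$ in $\mathbf R^N\times(0,\infty)$. For $0<T\le\infty$ and a nonnegative Radon measure $\mu$ on $\mathbf R^N$, a solution in $\mathbf R^N\times[0,T)$ of $$\partial_t u+(-\Delta)^{\theta/2}u=|x|^{-\gamma}u^p,\qquad u(0)=\mu,$$ is a nonnegative measurable function $u$ on $\mathbf R^N\times(0,T)$ such that $$\infty>u(x,t)=\int_{\mathbf R^N}G(x-y,t)\,d\mu(y)+\int_0^t\!\!\int_{\mathbf R^N}G(x-y,t-s)\,|y|^{-\gamma}u(y,s)^p\,dy\,ds$$ for almost all $(x,t)\in\mathbf R^N\times(0,T)$. A nonnegative measurable function $\mu$ is identified with the measure $\mu\,dx$. **Theorem.** There is $\epsilon>0$, depending only on $N,\theta,p,\gamma$, such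 that for every $r>1$ with $$r\in\left(\frac{N(p-1)}{\theta-\gamma}-\epsilon,\ \frac{N(p-1)}{\theta-\gamma}\right)$$ there is a constant $C_3>0$, depending only on $N,\theta,p,\gamma$ and $r$, with the following property. If $0<T\le\infty$ and $\mu$ is a nonnegative measurable function on $\mathbf R^N$ satisfying $$\sup_{z\in\mathbf R^N}\left(\frac1{|B(z,\sigma)|}\int_{B(z,\sigma)}\mu(y)^r\,dy\right)^{1/r}\le C_3\,\sigma^{-\frac{\theta-\gamma}{p-1}}\qquad\text{for all }0<\sigma<T^{1/\theta}$$ (with $T^{1/\theta}=\infty$ if $T=\infty$), then the Cauchy problem has a solution in $\mathbf R^N\times[0,T)$. -/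

import Mathlib

open MeasureTheory Set
open scoped ENNReal FourierTransform

noncomputable section

/-- The fundamental solution `G(x, t)` of `∂ₜ v + (-Δ)^{θ/2} v = 0` in `ℝ^N × (0, ∞)`, that is, the
inverse Fourier transform of `ξ ↦ exp (-t |ξ|^θ)`:
`G(x, t) = (2π)^{-N} ∫ exp (i x·ξ) exp (-t |ξ|^θ) dξ`.
With Mathlib's normalisation `exp (2πi x·ξ)` of the Fourier transform, the symbol of
`(-Δ)^{θ/2}` is `(2π|ξ|)^θ`. The integral is real because the symbol is even. -/
def fracHeatKernel (N : ℕ) (θ : ℝ) (x : EuclideanSpace ℝ (Fin N)) (t : ℝ) : ℝ :=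
  ((𝓕⁻ (fun ξ : EuclideanSpace ℝ (Fin N) =>
    ((Real.exp (-t * (2 * Real.pi * ‖ξ‖) ^ θ) : ℝ) : ℂ))) x).re

/-- `[S(t)μ](x) = ∫ G(x - y, t) dμ(y)` for a (nonnegative) measure `μ`, with values in `[0, ∞]`. -/
def fracHeatSemigroup (N : ℕ) (θ t : ℝ) (μ : Measure (EuclideanSpace ℝ (Fin N)))
    (x : EuclideanSpace ℝ (Fin N)) : ℝ≥0∞ :=
  ∫⁻ y, ENNReal.ofReal (fracHeatKernel N θ (x - y) t) ∂μ

/-- The space-time domain `ℝ^N × (0, T)`, where `T ∈ [0, ∞]`. -/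
def spaceTime (N : ℕ) (T : ℝ≥0∞) : Set (EuclideanSpace ℝ (Fin N) × ℝ) :=
  {q | 0 < q.2 ∧ ENNReal.ofReal q.2 < T}

/-- `u` is a solution in `ℝ^N × [0, T)` of the Cauchy problem
`∂ₜ u + (-Δ)^{θ/2} u = |x|^{-γ} u^p`, `u(0) = μ`: it is a nonnegative measurable function on
`ℝ^N × (0, T)` such that, for almost all `(x, t) ∈ ℝ^N × (0, T)`,
`∞ > u(x, t) = ∫ G(x - y, t) dμ(y) + ∫₀ᵗ ∫ G(x - y, t - s) |y|^{-γ} u(y, s)^p dy ds`.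
The values of `u` outside `ℝ^N × (0, T)` play no role. -/
structure IsHardySolution (N : ℕ) (θ γ p : ℝ) (μ : Measure (EuclideanSpace ℝ (Fin N)))
    (T : ℝ≥0∞) (u : EuclideanSpace ℝ (Fin N) × ℝ → ℝ≥0∞) : Prop where
  aemeasurable : AEMeasurable u (volume.restrict (spaceTime N T))
  finite : ∀ᵐ q ∂(volume.restrict (spaceTime N T)), u q < ∞
  eq : ∀ᵐ q ∂(volume.restrict (spaceTime N T)),
    u q = fracHeatSemigroup N θ q.2 μ q.1 +
      ∫⁻ s in Ioo 0 q.2, ∫⁻ y,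
        ENNReal.ofReal (fracHeatKernel N θ (q.1 - y) (q.2 - s)) * (‖y‖ₑ ^ (-γ) * u (y, s) ^ p)

end

/-!
A finite supersolution of the integral equation suffices: monotone iteration started at `0` stays
below it and converges to a solution (`exists_isHardySolution_of_duhamelMap_le`). For this only an
upper bound for the positive part of the fundamental solution `G` is needed, neither its positivity
nor its semigroup property.

*The kernel bound.* With `ρ = t^(1/θ)`, one has `|G(x, t)| ≤ C ρ^θ / (ρ + |x|)^(N+θ)`
(`exists_abs_fracHeatKernel_le_polyKernel`). Near the origin this is the `L¹` norm of the symbol. Far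
away, take `h = x / (2|x|²)`: a difference of order `k` with step `h` multiplies the inverse
transform at `x` by `(-2)^k`, so that `2^k |G(x, t)|` is at most the `L¹` norm of the `k`-th
difference of `exp (-t (2π|ξ|)^θ)`. For `|ξ| ≲ |h|` that difference is of size `t |h|^θ`, because
the symbol is within `t (2π|ξ|)^θ` of `1`. For `|ξ| ≳ |h|` the symbol extends holomorphically along
the complex line `ξ + z h`, `|z| ≲ |ξ| / |h|`, and iterated Cauchy estimates give
`t |ξ|^θ (|h| / |ξ|)^k` (`norm_fwdDiff_iter_fracHeatSymbol_le`). For `k = N + 3` the sum is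
integrable, with integral of size `t |h|^(θ+N)`.

*The majorant.* The kernel `Q` on the right-hand side of this bound satisfies
`min (Q_s(a), Q_t(b)) ≤ C Q_{s+t}(a + b)`, whence the weighted almost-semigroup property
`∫ Q_s(x-y) |y|^{-γ} Q_t(y-z) dy ≤ C (s^{-γ/θ} + t^{-γ/θ}) Q_{s+t}(x-z)`
(`exists_lintegral_heatMajorant_mul_heatMajorant_le`). A convolution with `Q_t` is bounded by the
averages over balls of radius `t^{1/θ}` (`exists_lintegral_polyKernel_mul_le_of_average_le`).

*The supersolution.* By Jensen's inequality the Morrey condition passes from `r` to any smaller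
exponent, so one may take `1 < s < p`. Put `U(t) = Q_t * μ^s`. The Morrey condition says that
`U ≤ B (C₃ t^{-β})^s` with `β = (θ - γ) / (θ (p - 1))`, and Hölder's inequality that the linear part
of the equation is at most a multiple of `U^{1/s}`. In the nonlinear part,
`(U^{1/s})^p ≤ (B C₃^s t^{-βs})^{p/s-1} U`, so that the weighted almost-semigroup property yields a
multiple of `U(t)`, which is once more compared with `U^{1/s}`. The powers of `t` cancel and the
factor `C₃^{p-1}` remains: for small `C₃`, a multiple of `U^{1/s}` is a supersolution
(`exists_duhamelMap_heatPotential_le`).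
-/

/-! ### Iterated differences and the Fourier transform -/

/-- Iterated Cauchy estimate: a `k`-th difference of a bounded holomorphic function is small of
order `k` in the ratio of the step to the radius. -/
theorem norm_fwdDiff_iter_le_of_differentiableOn {F : ℂ → ℂ} {c h : ℂ} {B δ R : ℝ} (hδ : 0 < δ)
    (hh : ‖h‖ ≤ δ) (hF : DifferentiableOn ℂ F (Metric.ball c R))
    (hB : ∀ z ∈ Metric.ball c R, ‖F z‖ ≤ B) (k : ℕ) :
    DifferentiableOn ℂ ((fwdDiff h)^[k] F) (Metric.ball c (R - k * (2 * δ))) ∧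
      ∀ z ∈ Metric.ball c (R - k * (2 * δ)), ‖(fwdDiff h)^[k] F z‖ ≤ B * (‖h‖ / δ) ^ k := by
  induction k with
  | zero => simpa using ⟨hF, hB⟩
  | succ k ih =>
    obtain ⟨hd, hb⟩ := ih
    set f := (fwdDiff h)^[k] F
    rw [Function.iterate_succ_apply']
    set R' := R - k * (2 * δ)
    have hR' : R - ((k + 1 : ℕ) : ℝ) * (2 * δ) = R' - 2 * δ := by
      simp only [R']; push_cast; ring
    rw [hR']
    have hadd : ∀ z ∈ Metric.ball c (R' - 2 * δ), z + h ∈ Metric.ball c R' := by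
      intro z hz
      rw [Metric.mem_ball, dist_eq_norm] at hz ⊢
      have := norm_add_le (z - c) h
      rw [show z + h - c = z - c + h by ring]
      linarith
    have hsub : Metric.ball c (R' - 2 * δ) ⊆ Metric.ball c R' :=
      Metric.ball_subset_ball (by linarith)
    refine ⟨?_, ?_⟩
    · refine DifferentiableOn.sub ?_ (hd.mono hsub)
      exact hd.comp (by fun_prop) hadd
    · intro z hz
      have hw : ∀ w ∈ Metric.closedBall z δ, Metric.closedBall w δ ⊆ Metric.ball c R' := by
        intro w hw v hv
        rw [Metric.mem_closedBall] at hw hv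
        rw [Metric.mem_ball] at hz ⊢
        have := dist_triangle v w c
        have := dist_triangle w z c
        linarith
      have hderiv : ∀ w ∈ Metric.closedBall z δ, ‖deriv f w‖ ≤ B * (‖h‖ / δ) ^ k / δ := by
        intro w hwz
        apply Complex.norm_deriv_le_of_forall_mem_sphere_norm_le hδ
        · exact DifferentiableOn.diffContOnCl
            (by rw [closure_ball _ hδ.ne']; exact hd.mono (hw w hwz))
        · intro v hv
          exact hb v (hw w hwz (Metric.sphere_subset_closedBall hv))
      have hmv := (convex_closedBall z δ).norm_image_sub_le_of_norm_deriv_le (𝕜 := ℂ) (f := f)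
        (fun w hwz => (hd.differentiableAt (Metric.isOpen_ball.mem_nhds
          (hw w hwz (Metric.mem_closedBall_self hδ.le))))) hderiv
        (Metric.mem_closedBall_self hδ.le) (y := z + h) (by simpa [dist_eq_norm] using hh)
      calc ‖fwdDiff h f z‖ = ‖f (z + h) - f z‖ := rfl
        _ ≤ _ := hmv
        _ = B * (‖h‖ / δ) ^ (k + 1) := by
          rw [add_sub_cancel_left, pow_succ]; ring

theorem Complex.norm_exp_neg_sub_one_le_of_re_nonneg {w : ℂ} (hw : 0 ≤ w.re) :
    ‖Complex.exp (-w) - 1‖ ≤ 2 * ‖w‖ := by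
  rcases le_total ‖w‖ 1 with h | h
  · simpa using Complex.norm_exp_sub_one_le (x := -w) (by simpa using h)
  · have h1 : ‖Complex.exp (-w)‖ ≤ 1 := by
      rw [Complex.norm_exp]; simpa using hw
    have := norm_sub_le (Complex.exp (-w)) 1
    simp only [norm_one] at this
    linarith

theorem Complex.re_cpow_nonneg_of_re_pos {z : ℂ} (hz : 0 < z.re) {a : ℝ} (ha : 0 ≤ a)
    (ha1 : a ≤ 1) : 0 ≤ (z ^ (a : ℂ)).re := by
  have hz0 : z ≠ 0 := by rintro rfl; simp at hz
  rw [Complex.cpow_def_of_ne_zero hz0, Complex.exp_re]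
  refine mul_nonneg (Real.exp_pos _).le (Real.cos_nonneg_of_mem_Icc ?_)
  have him : (Complex.log z * (a : ℂ)).im = a * Complex.arg z := by
    simp [Complex.mul_im, Complex.log_im, mul_comm]
  rw [him]
  have harg := abs_le.1 ((Complex.abs_arg_lt_pi_div_two_iff.2 (Or.inl hz)).le)
  have hpi := Real.pi_pos
  constructor <;> nlinarith [harg.1, harg.2]

/-- Difference of order `k` of a function whose pointwise values are bounded on the nodes: the
binomial coefficients add up to `2 ^ k`. -/
theorem norm_fwdDiff_iter_le_of_forall_le {M E : Type*} [AddCommMonoid M]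
    [SeminormedAddCommGroup E] {f : M → E} {h y : M} {B : ℝ} {k : ℕ}
    (hB : ∀ j ≤ k, ‖f (y + j • h)‖ ≤ B) : ‖(fwdDiff h)^[k] f y‖ ≤ 2 ^ k * B := by
  rw [fwdDiff_iter_eq_sum_shift]
  calc _ ≤ ∑ j ∈ Finset.range (k + 1), (k.choose j : ℝ) * B := by
        refine norm_sum_le_of_le _ fun j hj => ?_
        refine (norm_zsmul_le _ _).trans ?_
        have hB' := hB j (by simpa [Nat.lt_succ_iff] using hj)
        have : ‖((-1 : ℤ) ^ (k - j) * (k.choose j : ℤ))‖ = (k.choose j : ℝ) := by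
          rw [norm_mul, norm_pow]; simp
        rw [this]
        gcongr
    _ = 2 ^ k * B := by
        rw [← Finset.sum_mul]; congr 1
        exact_mod_cast congrArg (Nat.cast (R := ℝ)) (Nat.sum_range_choose k)

section Fourier

variable {V : Type*} [NormedAddCommGroup V] [InnerProductSpace ℝ V] [MeasurableSpace V]
  [BorelSpace V] [FiniteDimensional ℝ V]

theorem norm_fourierInv_le_integral_norm (f : V → ℂ) (x : V) : ‖𝓕⁻ f x‖ ≤ ∫ v, ‖f v‖ := by
  rw [Real.fourierInv_eq]
  refine (norm_integral_le_integral_norm _).trans (le_of_eq ?_)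
  simp

theorem MeasureTheory.Integrable.fwdDiff_iter {f : V → ℂ} (hf : Integrable f) (h : V) (k : ℕ) :
    Integrable ((fwdDiff h)^[k] f) := by
  induction k with
  | zero => simpa using hf
  | succ k ih =>
    rw [Function.iterate_succ_apply']
    exact (ih.comp_add_right h).sub ih

/-- If `2⟨h, x⟩ = 1` then a translation by `h` multiplies the inverse Fourier transform at `x` by
`-1`, so that each difference multiplies it by `-2`. -/
theorem fourierInv_fwdDiff_iter {f : V → ℂ} (hf : Integrable f) {h x : V}
    (hx : inner ℝ h x = 1 / 2) (k : ℕ) :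
    𝓕⁻ ((fwdDiff h)^[k] f) x = (-2) ^ k * 𝓕⁻ f x := by
  induction k with
  | zero => simp
  | succ k ih =>
    rw [Function.iterate_succ_apply']
    set g := (fwdDiff h)^[k] f
    have hg : Integrable g := hf.fwdDiff_iter h k
    have key : 𝓕⁻ (fun v => g (v + h)) x = - 𝓕⁻ g x := by
      rw [Real.fourierInv_eq', Real.fourierInv_eq', ← integral_neg,
        ← integral_add_right_eq_self (fun v => -(Complex.exp (↑(2 * Real.pi * inner ℝ v x) *
          Complex.I) • g v)) h]
      refine integral_congr_ae (Filter.Eventually.of_forall fun v => ?_)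
      simp only [inner_add_left, hx]
      rw [show ((2 * Real.pi * (inner ℝ v x + 1 / 2) : ℝ) : ℂ) * Complex.I =
        ((2 * Real.pi * inner ℝ v x : ℝ) : ℂ) * Complex.I + Real.pi * Complex.I by
          push_cast; ring, Complex.exp_add, Complex.exp_pi_mul_I]
      simp
    have hsub : 𝓕⁻ (fwdDiff h g) x = 𝓕⁻ (fun v => g (v + h)) x - 𝓕⁻ g x := by
      rw [Real.fourierInv_eq, Real.fourierInv_eq, Real.fourierInv_eq, ← integral_sub]
      · simp only [fwdDiff, smul_sub]
      · have := (Real.fourierIntegral_convergent_iff (-x)).2 (hg.comp_add_right h)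
        simpa using this
      · have := (Real.fourierIntegral_convergent_iff (-x)).2 hg
        simpa using this
    rw [hsub, key, ih, pow_succ]; ring

end Fourier

/-! ### Differences of the symbol -/

section Symbol

variable {V : Type*} [NormedAddCommGroup V]

theorem fwdDiff_iter_succ_sub_const {M G : Type*} [AddCommMonoid M] [AddCommGroup G] (f : M → G)
    (c : G) (h : M) (k : ℕ) :
    (fwdDiff h)^[k + 1] (fun v => f v - c) = (fwdDiff h)^[k + 1] f := by
  rw [Function.iterate_succ_apply, Function.iterate_succ_apply]
  congr 1
  funext v
  simp [fwdDiff]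

/-- The Fourier symbol `exp (-t (2π|ξ|)^θ)` of the fundamental solution. -/
noncomputable def fracHeatSymbol (θ t : ℝ) (ξ : V) : ℂ :=
  ((Real.exp (-t * (2 * Real.pi * ‖ξ‖) ^ θ) : ℝ) : ℂ)

theorem norm_fracHeatSymbol_sub_one_le {θ t : ℝ} (ht : 0 ≤ t) (ξ : V) :
    ‖fracHeatSymbol θ t ξ - 1‖ ≤ t * (2 * Real.pi * ‖ξ‖) ^ θ := by
  have h0 : 0 ≤ t * (2 * Real.pi * ‖ξ‖) ^ θ := by positivity
  rw [fracHeatSymbol, ← Complex.ofReal_one, ← Complex.ofReal_sub, Complex.norm_real,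
    Real.norm_eq_abs, abs_sub_comm, abs_of_nonneg]
  · have := Real.add_one_le_exp (-t * (2 * Real.pi * ‖ξ‖) ^ θ)
    linarith
  · rw [sub_nonneg, Real.exp_le_one_iff]; linarith

/-- Away from the origin on the scale of the step `h`, the symbol extends holomorphically along the
complex line `ξ + z h`, `|z| < |ξ| / (4|h|)`, where `|ξ + z h|²` becomes a quadratic polynomial with
values in the right half-plane. The Cauchy estimates then bound its differences. -/
theorem norm_fwdDiff_iter_fracHeatSymbol_le [InnerProductSpace ℝ V] {θ t : ℝ} (hθ : 0 < θ)
    (hθ2 : θ ≤ 2) (ht : 0 ≤ t) {ξ h : V} (hh : h ≠ 0) {k : ℕ}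
    (hξ : 16 * ((k + 1 : ℕ) : ℝ) * ‖h‖ ≤ ‖ξ‖) :
    ‖(fwdDiff h)^[k + 1] (fracHeatSymbol θ t) ξ‖ ≤
      4 * (t * (2 * Real.pi * ‖ξ‖) ^ θ) * (16 * ((k + 1 : ℕ) : ℝ) * ‖h‖ / ‖ξ‖) ^ (k + 1) := by
  have hh' : 0 < ‖h‖ := norm_pos_iff.2 hh
  have hk : (0 : ℝ) < ((k + 1 : ℕ) : ℝ) := by positivity
  have hξ0 : 0 < ‖ξ‖ := lt_of_lt_of_le (by positivity) hξ
  set q : ℂ → ℂ := fun z => ((‖ξ‖ ^ 2 : ℝ) : ℂ) +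
    (2 * z * ((inner ℝ ξ h : ℝ) : ℂ) + z ^ 2 * ((‖h‖ ^ 2 : ℝ) : ℂ)) with hq
  set F : ℂ → ℂ := fun z =>
    Complex.exp (-(((t * (2 * Real.pi) ^ θ : ℝ) : ℂ) * q z ^ ((θ / 2 : ℝ) : ℂ))) - 1 with hF
  set R : ℝ := ‖ξ‖ / (4 * ‖h‖) with hR
  set δ : ℝ := ‖ξ‖ / (16 * ((k + 1 : ℕ) : ℝ) * ‖h‖) with hδ
  have hδ1 : 1 ≤ δ := by rw [hδ, one_le_div (by positivity)]; exact hξ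
  have hpert : ∀ z ∈ Metric.ball (0 : ℂ) R,
      ‖2 * z * ((inner ℝ ξ h : ℝ) : ℂ) + z ^ 2 * ((‖h‖ ^ 2 : ℝ) : ℂ)‖ ≤ 9 / 16 * ‖ξ‖ ^ 2 := by
    intro z hz
    rw [mem_ball_zero_iff, hR, lt_div_iff₀ (by positivity)] at hz
    have hin := abs_real_inner_le_norm ξ h
    have hz0 := norm_nonneg z
    have ha : ‖z‖ * ‖h‖ ≤ ‖ξ‖ / 4 := by linarith
    calc _ ≤ ‖2 * z * ((inner ℝ ξ h : ℝ) : ℂ)‖ + ‖z ^ 2 * ((‖h‖ ^ 2 : ℝ) : ℂ)‖ := norm_add_le _ _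
      _ = 2 * ‖z‖ * |inner ℝ ξ h| + ‖z‖ ^ 2 * ‖h‖ ^ 2 := by
        simp [norm_pow]
      _ ≤ 2 * ‖z‖ * (‖ξ‖ * ‖h‖) + (‖z‖ * ‖h‖) ^ 2 := by rw [mul_pow]; gcongr
      _ = 2 * ‖ξ‖ * (‖z‖ * ‖h‖) + (‖z‖ * ‖h‖) ^ 2 := by ring
      _ ≤ 2 * ‖ξ‖ * (‖ξ‖ / 4) + (‖ξ‖ / 4) ^ 2 := by gcongr
      _ = _ := by ring
  have hre : ∀ z ∈ Metric.ball (0 : ℂ) R, 0 < (q z).re := by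
    intro z hz
    have h1 := (Complex.abs_re_le_norm _).trans (hpert z hz)
    have h2 := neg_le_of_abs_le h1
    rw [hq]
    simp only [Complex.add_re, Complex.ofReal_re] at h2 ⊢
    nlinarith [sq_pos_of_pos hξ0]
  have hnorm : ∀ z ∈ Metric.ball (0 : ℂ) R, ‖q z‖ ≤ 2 * ‖ξ‖ ^ 2 := by
    intro z hz
    refine (norm_add_le _ _).trans ?_
    have := hpert z hz
    rw [Complex.norm_real, Real.norm_eq_abs, abs_of_nonneg (by positivity)]
    nlinarith [sq_pos_of_pos hξ0]
  have hFd : DifferentiableOn ℂ F (Metric.ball 0 R) := by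
    have hqd : DifferentiableOn ℂ q (Metric.ball 0 R) := by
      simp only [hq]; fun_prop
    refine DifferentiableOn.sub_const ?_ 1
    refine DifferentiableOn.cexp (DifferentiableOn.neg (DifferentiableOn.const_mul ?_ _))
    exact hqd.cpow (differentiableOn_const _) (fun z hz => Or.inl (hre z hz))
  have hFb : ∀ z ∈ Metric.ball (0 : ℂ) R, ‖F z‖ ≤ 4 * (t * (2 * Real.pi * ‖ξ‖) ^ θ) := by
    intro z hz
    have hre' : 0 ≤ (((t * (2 * Real.pi) ^ θ : ℝ) : ℂ) * q z ^ ((θ / 2 : ℝ) : ℂ)).re := by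
      rw [Complex.re_ofReal_mul]
      exact mul_nonneg (by positivity)
        (Complex.re_cpow_nonneg_of_re_pos (hre z hz) (by positivity) (by linarith))
    refine (Complex.norm_exp_neg_sub_one_le_of_re_nonneg hre').trans ?_
    rw [norm_mul, Complex.norm_real, Real.norm_eq_abs, abs_of_nonneg (by positivity),
      Complex.norm_cpow_real]
    have h2 : ‖q z‖ ^ (θ / 2) ≤ 2 * ‖ξ‖ ^ θ := by
      calc ‖q z‖ ^ (θ / 2) ≤ (2 * ‖ξ‖ ^ 2) ^ (θ / 2) := by
            gcongr; exact hnorm z hz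
        _ = 2 ^ (θ / 2) * ‖ξ‖ ^ θ := by
            rw [Real.mul_rpow (by norm_num) (by positivity), ← Real.rpow_natCast,
              ← Real.rpow_mul hξ0.le]
            congr 2; push_cast; ring
        _ ≤ 2 ^ (1 : ℝ) * ‖ξ‖ ^ θ := by
            gcongr
            · norm_num
            · linarith
        _ = _ := by rw [Real.rpow_one]
    rw [Real.mul_rpow (by positivity) hξ0.le]
    have h3 : 0 ≤ t * (2 * Real.pi) ^ θ := by positivity
    nlinarith [mul_le_mul_of_nonneg_left h2 h3]
  have hFr : ∀ j : ℕ, F (0 + j • (1 : ℂ)) = fracHeatSymbol θ t (ξ + j • h) - 1 := by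
    intro j
    have hqj : q (0 + j • (1 : ℂ)) = ((‖ξ + j • h‖ ^ 2 : ℝ) : ℂ) := by
      have : ‖ξ + (j : ℝ) • h‖ ^ 2 = ‖ξ‖ ^ 2 + (2 * j * inner ℝ ξ h + j ^ 2 * ‖h‖ ^ 2) := by
        rw [norm_add_sq_real, inner_smul_right, norm_smul]; simp; ring
      rw [← Nat.cast_smul_eq_nsmul ℝ j h, this, hq]
      simp
    rw [hF]
    simp only
    rw [hqj, ← Complex.ofReal_cpow (by positivity), ← Complex.ofReal_mul, ← Complex.ofReal_neg,
      ← Complex.ofReal_exp, fracHeatSymbol, ← Real.rpow_natCast, ← Real.rpow_mul (norm_nonneg _),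
      Real.mul_rpow (by positivity) (norm_nonneg _)]
    congr 4
    push_cast
    rw [show (2 : ℝ) * (θ / 2) = θ by ring]; ring
  have heq : (fwdDiff h)^[k + 1] (fracHeatSymbol θ t) ξ = (fwdDiff (1 : ℂ))^[k + 1] F 0 := by
    rw [← fwdDiff_iter_succ_sub_const _ 1, fwdDiff_iter_eq_sum_shift, fwdDiff_iter_eq_sum_shift]
    simp only [hFr]
  rw [heq]
  have := (norm_fwdDiff_iter_le_of_differentiableOn (h := 1) (lt_of_lt_of_le one_pos hδ1)
    (by simpa using hδ1) hFd hFb (k + 1)).2 0 (by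
      rw [mem_ball_zero_iff, norm_zero, hR, hδ]
      have : ‖ξ‖ / (4 * ‖h‖) - ((k + 1 : ℕ) : ℝ) * (2 * (‖ξ‖ / (16 * ((k + 1 : ℕ) : ℝ) * ‖h‖))) =
        ‖ξ‖ / (8 * ‖h‖) := by field_simp; ring
      rw [this]; positivity)
  refine this.trans (le_of_eq ?_)
  rw [norm_one, hδ, one_div_div]

end Symbol

/-! ### Bounds for the fundamental solution -/

section KernelBounds

variable {N : ℕ} {θ : ℝ}

theorem abs_fracHeatKernel_le_norm (x : EuclideanSpace ℝ (Fin N)) (t : ℝ) :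
    |fracHeatKernel N θ x t| ≤ ‖𝓕⁻ (fracHeatSymbol θ t : EuclideanSpace ℝ (Fin N) → ℂ) x‖ :=
  Complex.abs_re_le_norm _

theorem norm_fracHeatSymbol (t : ℝ) (ξ : EuclideanSpace ℝ (Fin N)) :
    ‖fracHeatSymbol θ t ξ‖ = Real.exp (-(t * (2 * Real.pi) ^ θ) * ‖ξ‖ ^ θ) := by
  rw [fracHeatSymbol, Complex.norm_real, Real.norm_eq_abs, Real.abs_exp,
    Real.mul_rpow (by positivity) (norm_nonneg _)]
  ring_nf

theorem integrable_fracHeatSymbol (hN : 1 ≤ N) (hθ : 0 < θ) {t : ℝ} (ht : 0 < t) :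
    Integrable (fracHeatSymbol θ t : EuclideanSpace ℝ (Fin N) → ℂ) := by
  have : Nontrivial (EuclideanSpace ℝ (Fin N)) :=
    Module.nontrivial_of_finrank_pos (R := ℝ) (by simp; omega)
  have hmeas : AEStronglyMeasurable
      (fracHeatSymbol θ t : EuclideanSpace ℝ (Fin N) → ℂ) volume := by
    refine Measurable.aestronglyMeasurable ?_
    unfold fracHeatSymbol
    fun_prop
  rw [← integrable_norm_iff hmeas]
  simp only [norm_fracHeatSymbol]
  rw [integrable_fun_norm_addHaar volume
    (f := fun r => Real.exp (-(t * (2 * Real.pi) ^ θ) * r ^ θ))]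
  have := integrableOn_rpow_mul_exp_neg_mul_rpow (p := θ) (s := ((N - 1 : ℕ) : ℝ))
    (b := t * (2 * Real.pi) ^ θ) (by linarith [(Nat.cast_nonneg (N - 1) : (0 : ℝ) ≤ _)]) hθ
    (by positivity)
  simpa [Real.rpow_natCast] using this

theorem exists_abs_fracHeatKernel_le_rpow (hN : 1 ≤ N) (hθ : 0 < θ) :
    ∃ C : ℝ, 0 ≤ C ∧ ∀ t : ℝ, 0 < t → ∀ x : EuclideanSpace ℝ (Fin N),
      |fracHeatKernel N θ x t| ≤ C * t ^ (-(N / θ)) := by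
  have : Nontrivial (EuclideanSpace ℝ (Fin N)) :=
    Module.nontrivial_of_finrank_pos (R := ℝ) (by simp; omega)
  set D : ℝ := volume.real (Metric.ball (0 : EuclideanSpace ℝ (Fin N)) 1) with hD
  refine ⟨N * (D * (((2 * Real.pi) ^ θ) ^ (-(N / θ)) * (1 / θ) * Real.Gamma (N / θ))),
    ?_, fun t ht x => ?_⟩
  · have : 0 ≤ D := measureReal_nonneg
    have : 0 ≤ Real.Gamma (N / θ) := Real.Gamma_nonneg_of_nonneg (by positivity)
    positivity
  refine (abs_fracHeatKernel_le_norm x t).trans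
    ((norm_fourierInv_le_integral_norm _ x).trans (le_of_eq ?_))
  simp only [norm_fracHeatSymbol]
  rw [integral_fun_norm_addHaar volume
    (fun r => Real.exp (-(t * (2 * Real.pi) ^ θ) * r ^ θ))]
  have h := integral_rpow_mul_exp_neg_mul_rpow (p := θ) (q := ((N - 1 : ℕ) : ℝ))
    (b := t * (2 * Real.pi) ^ θ) hθ (by linarith [(Nat.cast_nonneg (N - 1) : (0 : ℝ) ≤ _)])
    (by positivity)
  have hN' : ((N - 1 : ℕ) : ℝ) + 1 = N := by rw [Nat.cast_sub hN]; push_cast; ring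
  simp only [Real.rpow_natCast] at h
  rw [hN'] at h
  simp only [finrank_euclideanSpace, Fintype.card_fin, smul_eq_mul, nsmul_eq_mul]
  rw [h, neg_div, Real.mul_rpow ht.le (by positivity), ← hD]
  ring

/-- The differences of order `N + 3` of the symbol with step `h` are integrable with the right
power of `|h|`: of size `t |h|^θ` near the origin, and decaying like `(|h| / |ξ|)^(N+1)`. -/
theorem exists_norm_fwdDiff_iter_fracHeatSymbol_le (hθ : 0 < θ) (hθ2 : θ ≤ 2) :
    ∃ C : ℝ, 0 ≤ C ∧ ∀ t : ℝ, 0 ≤ t → ∀ ξ h : EuclideanSpace ℝ (Fin N), h ≠ 0 →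
      ‖(fwdDiff h)^[N + 3] (fracHeatSymbol θ t) ξ‖ ≤
        C * t * ‖h‖ ^ θ * ((1 + ‖ξ‖ / ‖h‖) ^ (N + 1))⁻¹ := by
  set K : ℝ := ((N + 3 : ℕ) : ℝ) with hK
  set A : ℝ := 16 * K with hA
  have hK1 : 1 ≤ K := by rw [hK]; exact_mod_cast (by omega : 1 ≤ N + 3)
  set C₁ : ℝ := 2 ^ (N + 3) * (2 * Real.pi * (A + K)) ^ θ * (1 + A) ^ (N + 1) with hC₁
  set C₂ : ℝ := 4 * (2 * Real.pi) ^ θ * A ^ (N + 3) * 2 ^ (N + 1) with hC₂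
  have hA0 : 0 < A := by positivity
  have hC₁0 : 0 ≤ C₁ := by positivity
  have hC₂0 : 0 ≤ C₂ := by positivity
  refine ⟨C₁ + C₂, by positivity, fun t ht ξ h hh => ?_⟩
  have hh' : 0 < ‖h‖ := norm_pos_iff.2 hh
  set ρ : ℝ := ‖ξ‖ / ‖h‖ with hρ
  have hρ0 : 0 ≤ ρ := by positivity
  have hξ : ‖ξ‖ = ρ * ‖h‖ := by rw [hρ]; field_simp
  clear_value ρ
  -- `A` separates the range of the trivial bound from the range of the Cauchy estimates
  rcases le_total ρ A with hle | hle
  · have h1 : ‖(fwdDiff h)^[N + 3] (fracHeatSymbol θ t) ξ‖ ≤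
        2 ^ (N + 3) * (t * (2 * Real.pi * ((A + K) * ‖h‖)) ^ θ) := by
      rw [← fwdDiff_iter_succ_sub_const _ 1]
      refine norm_fwdDiff_iter_le_of_forall_le fun j hj => ?_
      refine (norm_fracHeatSymbol_sub_one_le ht _).trans ?_
      gcongr
      calc ‖ξ + j • h‖ ≤ ‖ξ‖ + ‖j • h‖ := norm_add_le _ _
        _ = ρ * ‖h‖ + j * ‖h‖ := by rw [hξ, ← Nat.cast_smul_eq_nsmul ℝ, norm_smul]; simp
        _ ≤ A * ‖h‖ + K * ‖h‖ := by gcongr; rw [hK]; exact_mod_cast hj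
        _ = _ := by ring
    have h2 : 1 ≤ (1 + A) ^ (N + 1) * ((1 + ρ) ^ (N + 1))⁻¹ := by
      rw [← div_eq_mul_inv, one_le_div (by positivity)]
      gcongr
    calc _ ≤ _ := h1
      _ = 2 ^ (N + 3) * (2 * Real.pi * (A + K)) ^ θ * t * ‖h‖ ^ θ * 1 := by
        rw [← mul_assoc (2 * Real.pi), Real.mul_rpow (by positivity) hh'.le]; ring
      _ ≤ 2 ^ (N + 3) * (2 * Real.pi * (A + K)) ^ θ * t * ‖h‖ ^ θ *
          ((1 + A) ^ (N + 1) * ((1 + ρ) ^ (N + 1))⁻¹) := by gcongr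
      _ = C₁ * t * ‖h‖ ^ θ * ((1 + ρ) ^ (N + 1))⁻¹ := by rw [hC₁]; ring
      _ ≤ _ := by gcongr; linarith
  · have hρ1 : 1 ≤ ρ := by linarith
    have hρp : 0 < ρ := by linarith
    have h1 := norm_fwdDiff_iter_fracHeatSymbol_le (k := N + 2) hθ hθ2 ht (ξ := ξ) hh
      (by rw [hξ]; gcongr)
    have h2 : ρ ^ θ * (A / ρ) ^ (N + 3) ≤ A ^ (N + 3) * (ρ ^ (N + 1))⁻¹ := by
      calc ρ ^ θ * (A / ρ) ^ (N + 3) ≤ ρ ^ (2 : ℝ) * (A / ρ) ^ (N + 3) := by gcongr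
        _ = A ^ (N + 3) * (ρ ^ (N + 1))⁻¹ := by
          rw [show (2 : ℝ) = ((2 : ℕ) : ℝ) by norm_num, Real.rpow_natCast, div_pow]
          field_simp
          ring
    have h3 : (ρ ^ (N + 1))⁻¹ ≤ 2 ^ (N + 1) * ((1 + ρ) ^ (N + 1))⁻¹ := by
      rw [← div_eq_mul_inv, inv_le_comm₀ (by positivity) (by positivity), inv_div, ← div_pow]
      gcongr
      linarith
    calc _ ≤ _ := h1
      _ = 4 * (2 * Real.pi) ^ θ * t * ‖h‖ ^ θ * (ρ ^ θ * (A / ρ) ^ (N + 3)) := by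
        have : 16 * ((N + 2 + 1 : ℕ) : ℝ) * ‖h‖ / ‖ξ‖ = A / ρ := by
          rw [hξ, mul_div_mul_right _ _ hh'.ne']
        rw [this, hξ, Real.mul_rpow (by positivity) (by positivity),
          Real.mul_rpow hρ0 hh'.le]
        ring
      _ ≤ 4 * (2 * Real.pi) ^ θ * t * ‖h‖ ^ θ *
          (A ^ (N + 3) * (2 ^ (N + 1) * ((1 + ρ) ^ (N + 1))⁻¹)) := by
        refine mul_le_mul_of_nonneg_left (h2.trans ?_) (by positivity)
        gcongr
      _ = C₂ * t * ‖h‖ ^ θ * ((1 + ρ) ^ (N + 1))⁻¹ := by rw [hC₂]; ring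
      _ ≤ _ := by gcongr; linarith

/-- Decay of the fundamental solution. The exponent `N + θ` is sharp for `θ < 2`, and comes from the
singularity `t |ξ|^θ` of the symbol at the origin. -/
theorem exists_abs_fracHeatKernel_le_norm_rpow (hN : 1 ≤ N) (hθ : 0 < θ) (hθ2 : θ ≤ 2) :
    ∃ C : ℝ, 0 ≤ C ∧ ∀ t : ℝ, 0 < t → ∀ x : EuclideanSpace ℝ (Fin N), x ≠ 0 →
      |fracHeatKernel N θ x t| ≤ C * t * ‖x‖ ^ (-(N + θ)) := by
  obtain ⟨C, hC, hb⟩ := exists_norm_fwdDiff_iter_fracHeatSymbol_le (N := N) hθ hθ2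
  set g : EuclideanSpace ℝ (Fin N) → ℝ := fun η => ((1 + ‖η‖) ^ (N + 1))⁻¹ with hg
  have hgi : Integrable g := by
    have := integrable_one_add_norm (E := EuclideanSpace ℝ (Fin N)) (μ := volume)
      (r := ((N + 1 : ℕ) : ℝ)) (by simp)
    refine this.congr (Filter.Eventually.of_forall fun η => ?_)
    simp only [hg]
    rw [Real.rpow_neg (by positivity), Real.rpow_natCast]
  have hg0 : 0 ≤ ∫ η, g η := integral_nonneg fun η => by simp only [hg]; positivity
  refine ⟨C * ∫ η, g η, by positivity, fun t ht x hx => ?_⟩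
  have hx' : 0 < ‖x‖ := norm_pos_iff.2 hx
  -- the step for which translation by `h` multiplies the transform at `x` by `-1`
  set h : EuclideanSpace ℝ (Fin N) := (1 / (2 * ‖x‖ ^ 2)) • x with hh
  have hnh : ‖h‖ = (2 * ‖x‖)⁻¹ := by
    rw [hh, norm_smul, Real.norm_eq_abs, abs_of_nonneg (by positivity)]
    field_simp
  have hh' : 0 < ‖h‖ := by rw [hnh]; positivity
  have hin : inner ℝ h x = 1 / 2 := by
    rw [hh, inner_smul_left, real_inner_self_eq_norm_sq]
    simp only [conj_trivial]
    field_simp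
  have hfi := integrable_fracHeatSymbol (N := N) hN hθ ht
  have hscale : ∫ ξ, g (‖h‖⁻¹ • ξ) = ‖h‖ ^ N * ∫ η, g η := by
    rw [Measure.integral_comp_smul_of_nonneg volume g _ (hR := by positivity)]
    simp
  have hgn : ∀ ξ, g (‖h‖⁻¹ • ξ) = ((1 + ‖ξ‖ / ‖h‖) ^ (N + 1))⁻¹ := by
    intro ξ
    simp only [hg, norm_smul, norm_inv, norm_norm]
    rw [inv_mul_eq_div]
  have hmain : ‖𝓕⁻ (fracHeatSymbol θ t : EuclideanSpace ℝ (Fin N) → ℂ) x‖ ≤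
      C * t * ‖h‖ ^ θ * (‖h‖ ^ N * ∫ η, g η) := by
    calc ‖𝓕⁻ (fracHeatSymbol θ t : EuclideanSpace ℝ (Fin N) → ℂ) x‖
        ≤ 2 ^ (N + 3) * ‖𝓕⁻ (fracHeatSymbol θ t : EuclideanSpace ℝ (Fin N) → ℂ) x‖ :=
          le_mul_of_one_le_left (norm_nonneg _) (one_le_pow₀ (by norm_num))
      _ = ‖𝓕⁻ ((fwdDiff h)^[N + 3] (fracHeatSymbol θ t)) x‖ := by
          rw [fourierInv_fwdDiff_iter hfi hin, norm_mul, norm_pow]; simp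
      _ ≤ ∫ ξ, ‖(fwdDiff h)^[N + 3] (fracHeatSymbol θ t) ξ‖ :=
          norm_fourierInv_le_integral_norm _ _
      _ ≤ ∫ ξ, C * t * ‖h‖ ^ θ * g (‖h‖⁻¹ • ξ) := by
          refine integral_mono (hfi.fwdDiff_iter h _).norm
            ((hgi.comp_smul (inv_ne_zero hh'.ne')).const_mul _) fun ξ => ?_
          simp only [hgn]
          exact hb t ht.le ξ h (norm_pos_iff.1 hh')
      _ = _ := by rw [integral_const_mul, hscale]
  refine (abs_fracHeatKernel_le_norm x t).trans (hmain.trans ?_)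
  have hpow : ‖h‖ ^ θ * ‖h‖ ^ N ≤ ‖x‖ ^ (-(N + θ)) := by
    rw [← Real.rpow_natCast, ← Real.rpow_add hh', hnh, Real.inv_rpow (by positivity),
      ← Real.rpow_neg (by positivity), add_comm θ]
    exact Real.rpow_le_rpow_of_nonpos hx' (by linarith) (by linarith [(N.cast_nonneg : (0:ℝ) ≤ N)])
  calc C * t * ‖h‖ ^ θ * (‖h‖ ^ N * ∫ η, g η)
      = (C * ∫ η, g η) * t * (‖h‖ ^ θ * ‖h‖ ^ N) := by ring
    _ ≤ _ := mul_le_mul_of_nonneg_left hpow (mul_nonneg (mul_nonneg hC hg0) ht.le)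

/-- The comparison kernel `ρ^θ / (ρ + |x|)^(N+θ)`, where `ρ = t^(1/θ)` is the length scale of the
time `t`. For `θ < 2` the fundamental solution is comparable to it; for `θ = 2` it is merely an
upper bound, which is all that is needed. -/
noncomputable def polyKernel (N : ℕ) (θ ρ : ℝ) (x : EuclideanSpace ℝ (Fin N)) : ℝ :=
  ρ ^ θ * (ρ + ‖x‖) ^ (-(N + θ))

theorem exists_abs_fracHeatKernel_le_polyKernel (hN : 1 ≤ N) (hθ : 0 < θ) (hθ2 : θ ≤ 2) :
    ∃ C : ℝ, 0 ≤ C ∧ ∀ t : ℝ, 0 < t → ∀ x : EuclideanSpace ℝ (Fin N),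
      |fracHeatKernel N θ x t| ≤ C * polyKernel N θ (t ^ (1 / θ)) x := by
  obtain ⟨C₁, hC₁, h₁⟩ := exists_abs_fracHeatKernel_le_rpow hN hθ
  obtain ⟨C₂, hC₂, h₂⟩ := exists_abs_fracHeatKernel_le_norm_rpow hN hθ hθ2
  have hM : 0 < (N : ℝ) + θ := by positivity
  refine ⟨(C₁ + C₂) * 2 ^ ((N : ℝ) + θ), by positivity, fun t ht x => ?_⟩
  set ρ := t ^ (1 / θ) with hρ
  have hρ0 : 0 < ρ := by positivity
  have htρ : t = ρ ^ θ := by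
    rw [hρ, ← Real.rpow_mul ht.le, one_div_mul_cancel hθ.ne', Real.rpow_one]
  -- both bounds are `ρ^θ R^(-(N+θ))` with `R = max ρ |x| ≥ (ρ + |x|) / 2`
  have key : ∀ R : ℝ, 0 < R → ρ + ‖x‖ ≤ 2 * R →
      R ^ (-((N : ℝ) + θ)) ≤ 2 ^ ((N : ℝ) + θ) * (ρ + ‖x‖) ^ (-((N : ℝ) + θ)) := by
    intro R hR hle
    have : 0 < ρ + ‖x‖ := by positivity
    calc R ^ (-((N : ℝ) + θ)) = 2 ^ ((N : ℝ) + θ) * (2 * R) ^ (-((N : ℝ) + θ)) := by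
          rw [Real.mul_rpow (by norm_num) hR.le, ← mul_assoc, ← Real.rpow_add (by norm_num)]
          simp
      _ ≤ _ := by
          gcongr ?_ * ?_
          exact Real.rpow_le_rpow_of_nonpos this hle (by linarith)
  unfold polyKernel
  rcases le_total ‖x‖ ρ with hle | hle
  · have h3 := key ρ hρ0 (by linarith)
    calc _ ≤ _ := h₁ t ht x
      _ = C₁ * (ρ ^ θ * ρ ^ (-((N : ℝ) + θ))) := by
        rw [← Real.rpow_add hρ0, htρ, ← Real.rpow_mul hρ0.le]
        congr 2; field_simp; ring
      _ ≤ (C₁ + C₂) * (ρ ^ θ * (2 ^ ((N : ℝ) + θ) * (ρ + ‖x‖) ^ (-((N : ℝ) + θ)))) := by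
        gcongr; linarith
      _ = _ := by ring
  · have hx : 0 < ‖x‖ := lt_of_lt_of_le hρ0 hle
    have h3 := key ‖x‖ hx (by linarith)
    calc _ ≤ _ := h₂ t ht x (norm_pos_iff.1 hx)
      _ = C₂ * (ρ ^ θ * ‖x‖ ^ (-((N : ℝ) + θ))) := by rw [htρ]; ring
      _ ≤ (C₁ + C₂) * (ρ ^ θ * (2 ^ ((N : ℝ) + θ) * (ρ + ‖x‖) ^ (-((N : ℝ) + θ)))) := by
        gcongr; linarith
      _ = _ := by ring

end KernelBounds

/-! ### Estimates for the comparison kernel -/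

section PolyKernel

variable {N : ℕ} {θ γ : ℝ}

local notation "ℝᴺ" => EuclideanSpace ℝ (Fin N)

theorem lintegral_comp_inv_smul (f : ℝᴺ → ℝ≥0∞) {ρ : ℝ} (hρ : 0 < ρ) :
    ∫⁻ y, f (ρ⁻¹ • y) = ENNReal.ofReal (ρ ^ N) * ∫⁻ y, f y := by
  have h1 := lintegral_map_equiv (μ := (volume : Measure ℝᴺ)) f
    (MeasurableEquiv.smul₀ ρ⁻¹ (inv_ne_zero hρ.ne'))
  simp only [MeasurableEquiv.coe_smul₀] at h1
  rw [← h1, Measure.map_addHaar_smul volume (inv_ne_zero hρ.ne'), lintegral_smul_measure]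
  simp [abs_of_pos hρ]

theorem measurable_polyKernel (ρ : ℝ) : Measurable (polyKernel N θ ρ) := by
  unfold polyKernel; fun_prop

theorem polyKernel_neg (ρ : ℝ) (x : ℝᴺ) : polyKernel N θ ρ (-x) = polyKernel N θ ρ x := by
  simp [polyKernel]

theorem polyKernel_eq_scale {ρ : ℝ} (hρ : 0 < ρ) (x : ℝᴺ) :
    polyKernel N θ ρ x = (ρ ^ N)⁻¹ * polyKernel N θ 1 (ρ⁻¹ • x) := by
  have h1 : ρ + ‖x‖ = ρ * (1 + ‖ρ⁻¹ • x‖) := by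
    rw [norm_smul, norm_inv, Real.norm_eq_abs, abs_of_pos hρ]; field_simp
  unfold polyKernel
  rw [h1, Real.mul_rpow hρ.le (by positivity), ← mul_assoc, ← Real.rpow_add hρ,
    Real.one_rpow, one_mul, ← Real.rpow_natCast, ← Real.rpow_neg hρ.le]
  congr 2; ring

theorem lintegral_polyKernel_one_ne_top (hθ : 0 < θ) :
    ∫⁻ y : ℝᴺ, ENNReal.ofReal (polyKernel N θ 1 y) ≠ ∞ := by
  have := finite_integral_one_add_norm (E := ℝᴺ) (μ := volume) (r := N + θ) (by simpa using hθ)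
  simpa [polyKernel] using this.ne

theorem lintegral_polyKernel {ρ : ℝ} (hρ : 0 < ρ) (x : ℝᴺ) :
    ∫⁻ y, ENNReal.ofReal (polyKernel N θ ρ (x - y)) =
      ∫⁻ y : ℝᴺ, ENNReal.ofReal (polyKernel N θ 1 y) := by
  rw [lintegral_sub_left_eq_self (fun y => ENNReal.ofReal (polyKernel N θ ρ y)) x]
  have : ∀ y : ℝᴺ, ENNReal.ofReal (polyKernel N θ ρ y) =
      ENNReal.ofReal (ρ ^ N)⁻¹ * ENNReal.ofReal (polyKernel N θ 1 (ρ⁻¹ • y)) := fun y => by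
    rw [← ENNReal.ofReal_mul (by positivity), ← polyKernel_eq_scale hρ]
  simp only [this]
  rw [lintegral_const_mul' _ _ ENNReal.ofReal_ne_top,
    lintegral_comp_inv_smul (fun y => ENNReal.ofReal (polyKernel N θ 1 y)) hρ, ← mul_assoc,
    ← ENNReal.ofReal_mul (by positivity), inv_mul_cancel₀ (by positivity), ENNReal.ofReal_one,
    one_mul]

theorem setLIntegral_ball_enorm_rpow_neg_ne_top (hN : 1 ≤ N) (hγN : γ < N) :
    ∫⁻ y in Metric.ball (0 : ℝᴺ) 1, ‖y‖ₑ ^ (-γ) ≠ ∞ := by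
  have : Nontrivial ℝᴺ := Module.nontrivial_of_finrank_pos (R := ℝ) (by simp; omega)
  have h1 : IntegrableOn (fun r : ℝ => r ^ (Module.finrank ℝ ℝᴺ - 1) • r ^ (-γ)) (Ioo 0 1) := by
    have h2 : IntegrableOn (fun r : ℝ => r ^ ((N : ℝ) - 1 - γ)) (Ioo 0 1) := by
      rw [intervalIntegral.integrableOn_Ioo_rpow_iff one_pos]; linarith
    refine h2.congr_fun (fun r hr => ?_) measurableSet_Ioo
    simp only [finrank_euclideanSpace, Fintype.card_fin, smul_eq_mul]
    rw [← Real.rpow_natCast, ← Real.rpow_add hr.1, Nat.cast_sub hN]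
    congr 1; push_cast; ring
  have h3 := (integrableOn_fun_norm_addHaar (volume : Measure ℝᴺ)
    (f := fun r : ℝ => r ^ (-γ)) (r := 1)).2 h1
  have h4 := h3.2
  rw [hasFiniteIntegral_iff_enorm] at h4
  refine ne_of_lt (lt_of_le_of_lt (lintegral_mono_ae ?_) h4)
  have h0 : ∀ᵐ y : ℝᴺ ∂(volume.restrict (Metric.ball 0 1)), y ≠ 0 :=
    ae_restrict_of_ae (by simp [ae_iff])
  filter_upwards [h0] with y hy
  have hy' : 0 < ‖y‖ := norm_pos_iff.2 hy
  rw [Real.enorm_eq_ofReal (by positivity), ← ENNReal.ofReal_rpow_of_pos hy', ofReal_norm]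

theorem polyKernel_one_le_one (hθ : 0 < θ) (x : ℝᴺ) : polyKernel N θ 1 x ≤ 1 := by
  unfold polyKernel
  rw [Real.one_rpow, one_mul]
  exact Real.rpow_le_one_of_one_le_of_nonpos (by linarith [norm_nonneg x])
    (by linarith [(N.cast_nonneg : (0:ℝ) ≤ N)])

theorem exists_lintegral_polyKernel_mul_enorm_rpow_le (hN : 1 ≤ N) (hθ : 0 < θ) (hγ : 0 < γ)
    (hγN : γ < N) : ∃ C : ℝ≥0∞, C ≠ ∞ ∧ ∀ ρ : ℝ, 0 < ρ → ∀ x : ℝᴺ,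
      ∫⁻ y, ENNReal.ofReal (polyKernel N θ ρ (x - y)) * ‖y‖ₑ ^ (-γ) ≤
        C * ENNReal.ofReal (ρ ^ (-γ)) := by
  refine ⟨(∫⁻ y in Metric.ball (0 : ℝᴺ) 1, ‖y‖ₑ ^ (-γ)) +
    ∫⁻ y : ℝᴺ, ENNReal.ofReal (polyKernel N θ 1 y),
    ENNReal.add_ne_top.2 ⟨setLIntegral_ball_enorm_rpow_neg_ne_top hN hγN,
      lintegral_polyKernel_one_ne_top hθ⟩, fun ρ hρ x => ?_⟩
  set f : ℝᴺ → ℝ≥0∞ := fun w =>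
    ENNReal.ofReal (polyKernel N θ 1 (ρ⁻¹ • x - w)) * ‖w‖ₑ ^ (-γ) with hf
  have hscale : ∀ y : ℝᴺ, ENNReal.ofReal (polyKernel N θ ρ (x - y)) * ‖y‖ₑ ^ (-γ) =
      ENNReal.ofReal (ρ ^ N)⁻¹ * ENNReal.ofReal (ρ ^ (-γ)) * f (ρ⁻¹ • y) := by
    intro y
    have h1 : ‖y‖ₑ ^ (-γ) = ENNReal.ofReal (ρ ^ (-γ)) * ‖ρ⁻¹ • y‖ₑ ^ (-γ) := by
      have : ‖y‖ₑ = ENNReal.ofReal ρ * ‖ρ⁻¹ • y‖ₑ := by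
        rw [← Real.enorm_eq_ofReal hρ.le, ← enorm_smul, smul_smul, mul_inv_cancel₀ hρ.ne',
          one_smul]
      rw [this, ENNReal.mul_rpow_of_ne_top ENNReal.ofReal_ne_top enorm_ne_top,
        ENNReal.ofReal_rpow_of_pos hρ]
    rw [polyKernel_eq_scale hρ, h1, ENNReal.ofReal_mul (by positivity), smul_sub]
    simp only [hf]; ring
  have hunit : ∫⁻ w, f w ≤ (∫⁻ y in Metric.ball (0 : ℝᴺ) 1, ‖y‖ₑ ^ (-γ)) +
      ∫⁻ y : ℝᴺ, ENNReal.ofReal (polyKernel N θ 1 y) := by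
    rw [← lintegral_polyKernel (θ := θ) one_pos (ρ⁻¹ • x), ← lintegral_indicator measurableSet_ball,
      ← lintegral_add_left ((by fun_prop : Measurable fun y : ℝᴺ => ‖y‖ₑ ^ (-γ)).indicator
        measurableSet_ball)]
    refine lintegral_mono fun w => ?_
    by_cases hw : w ∈ Metric.ball (0 : ℝᴺ) 1
    · rw [indicator_of_mem hw]
      refine le_add_right ?_
      refine mul_le_of_le_one_left (zero_le) ?_
      exact ENNReal.ofReal_le_one.2 (polyKernel_one_le_one hθ _)
    · rw [indicator_of_notMem hw, zero_add]
      refine mul_le_of_le_one_right (zero_le) ?_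
      refine ENNReal.rpow_le_one_of_one_le_of_neg ?_ (by linarith)
      rw [mem_ball_zero_iff, not_lt] at hw
      rw [← ofReal_norm, ← ENNReal.ofReal_one]
      exact ENNReal.ofReal_le_ofReal hw
  simp only [hscale]
  rw [lintegral_const_mul' _ _ (ENNReal.mul_ne_top ENNReal.ofReal_ne_top ENNReal.ofReal_ne_top),
    lintegral_comp_inv_smul f hρ]
  calc _ = ENNReal.ofReal (ρ ^ N)⁻¹ * ENNReal.ofReal (ρ ^ N) * (ENNReal.ofReal (ρ ^ (-γ)) *
        ∫⁻ w, f w) := by ring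
    _ = ENNReal.ofReal (ρ ^ (-γ)) * ∫⁻ w, f w := by
      rw [← ENNReal.ofReal_mul (by positivity), inv_mul_cancel₀ (by positivity),
        ENNReal.ofReal_one, one_mul]
    _ ≤ _ := by rw [mul_comm]; gcongr

theorem polyKernel_le_of_dist_le (hθ : 0 < θ) {ρ : ℝ} (hρ : 0 < ρ) {a b : ℝᴺ}
    (hab : ‖a - b‖ ≤ ρ) : polyKernel N θ ρ a ≤ 2 ^ ((N : ℝ) + θ) * polyKernel N θ ρ b := by
  have hle : ρ + ‖b‖ ≤ 2 * (ρ + ‖a‖) := by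
    have := norm_sub_norm_le b a
    rw [norm_sub_rev] at this
    linarith [norm_nonneg a]
  have hb : 0 < ρ + ‖b‖ := by positivity
  have h1 : (ρ + ‖a‖) ^ (-((N : ℝ) + θ)) ≤
      2 ^ ((N : ℝ) + θ) * (ρ + ‖b‖) ^ (-((N : ℝ) + θ)) := by
    calc (ρ + ‖a‖) ^ (-((N : ℝ) + θ)) =
        2 ^ ((N : ℝ) + θ) * (2 * (ρ + ‖a‖)) ^ (-((N : ℝ) + θ)) := by
          rw [Real.mul_rpow (by norm_num) (by positivity), ← mul_assoc,
            ← Real.rpow_add (by norm_num)]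
          simp
      _ ≤ _ := by
          gcongr ?_ * ?_
          exact Real.rpow_le_rpow_of_nonpos hb hle (by linarith [(N.cast_nonneg : (0:ℝ) ≤ N)])
  unfold polyKernel
  calc _ ≤ ρ ^ θ * (2 ^ ((N : ℝ) + θ) * (ρ + ‖b‖) ^ (-((N : ℝ) + θ))) := by gcongr
    _ = _ := by ring

/-- A convolution with the comparison kernel at scale `ρ` is controlled by the averages over balls
of radius `ρ`: since the kernel varies by a bounded factor over such balls, `ν` may be replaced by
its averages. -/
theorem exists_lintegral_polyKernel_mul_le_of_average_le (hθ : 0 < θ) :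
    ∃ C : ℝ≥0∞, C ≠ ∞ ∧ ∀ ρ : ℝ, 0 < ρ → ∀ ν : ℝᴺ → ℝ≥0∞, Measurable ν → ∀ A : ℝ≥0∞,
      (∀ z, ∫⁻ y in Metric.ball z ρ, ν y ≤ volume (Metric.ball z ρ) * A) → ∀ x : ℝᴺ,
      ∫⁻ y, ENNReal.ofReal (polyKernel N θ ρ (x - y)) * ν y ≤ C * A := by
  set I := ∫⁻ y : ℝᴺ, ENNReal.ofReal (polyKernel N θ 1 y) with hI
  refine ⟨ENNReal.ofReal (2 ^ ((N : ℝ) + θ)) * I,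
    ENNReal.mul_ne_top ENNReal.ofReal_ne_top (lintegral_polyKernel_one_ne_top hθ),
    fun ρ hρ ν hν A hA x => ?_⟩
  set V := volume (Metric.ball (0 : ℝᴺ) ρ) with hV
  have hVz : ∀ z : ℝᴺ, volume (Metric.ball z ρ) = V := fun z =>
    Measure.addHaar_ball_center volume z ρ
  have hV0 : V ≠ 0 := (Metric.measure_ball_pos volume _ hρ).ne'
  have hVt : V ≠ ∞ := measure_ball_lt_top.ne
  set P : ℝᴺ → ℝ≥0∞ := fun y => ENNReal.ofReal (polyKernel N θ ρ (x - y)) with hP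
  have hPm : Measurable P := ((measurable_polyKernel ρ).comp
    (measurable_const.sub measurable_id)).ennreal_ofReal
  set c := ENNReal.ofReal (2 ^ ((N : ℝ) + θ)) with hc
  -- multiplying by the volume of a ball amounts to averaging the kernel over that ball
  have hharnack : ∀ y, V * P y ≤ c * ∫⁻ z in Metric.ball y ρ, P z := by
    intro y
    rw [← lintegral_const_mul _ hPm, ← hVz y, mul_comm, ← setLIntegral_const]
    refine setLIntegral_mono (by fun_prop) fun z hz => ?_
    rw [hP, hc, ← ENNReal.ofReal_mul (by positivity)]
    refine ENNReal.ofReal_le_ofReal (polyKernel_le_of_dist_le hθ hρ ?_)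
    rw [Metric.mem_ball, dist_eq_norm] at hz
    simpa using hz.le
  have hset : MeasurableSet {q : ℝᴺ × ℝᴺ | dist q.2 q.1 < ρ} :=
    measurableSet_lt (by fun_prop) measurable_const
  have hmain : V * ∫⁻ y, P y * ν y ≤ V * (c * I * A) := by
    calc V * ∫⁻ y, P y * ν y = ∫⁻ y, V * P y * ν y := by
          rw [← lintegral_const_mul _ (by fun_prop)]; simp only [mul_assoc]
      _ ≤ ∫⁻ y, (c * ∫⁻ z in Metric.ball y ρ, P z) * ν y := by
          exact lintegral_mono fun y => mul_le_mul_left (hharnack y) _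
      _ = c * ∫⁻ y, ∫⁻ z, {q : ℝᴺ × ℝᴺ | dist q.2 q.1 < ρ}.indicator
            (fun q => P q.2 * ν q.1) (y, z) := by
          rw [← lintegral_const_mul' _ _ ENNReal.ofReal_ne_top]
          refine lintegral_congr fun y => ?_
          rw [mul_assoc, ← lintegral_mul_const _ hPm, ← lintegral_indicator measurableSet_ball]
          rfl
      _ = c * ∫⁻ z, ∫⁻ y, {q : ℝᴺ × ℝᴺ | dist q.2 q.1 < ρ}.indicator
            (fun q => P q.2 * ν q.1) (y, z) := by
          rw [lintegral_lintegral_swap]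
          exact (Measurable.indicator (by fun_prop) hset).aemeasurable
      _ = c * ∫⁻ z, P z * ∫⁻ y in Metric.ball z ρ, ν y := by
          congr 1
          refine lintegral_congr fun z => ?_
          rw [← lintegral_const_mul _ hν, ← lintegral_indicator measurableSet_ball]
          refine lintegral_congr fun y => ?_
          simp only [indicator, mem_ofPred_eq, Metric.mem_ball, dist_comm]
      _ ≤ c * ∫⁻ z, P z * (V * A) := by
          gcongr with z
          rw [← hVz z]; exact hA z
      _ = V * (c * I * A) := by
          rw [lintegral_mul_const _ hPm, hP, lintegral_polyKernel hρ, ← hI]; ring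
  exact (ENNReal.mul_le_mul_iff_right hV0 hVt).1 hmain

/-- The majorant of the fundamental solution at time `t`, with values in `[0, ∞]`. -/
noncomputable def heatMajorant (N : ℕ) (θ t : ℝ) (x : EuclideanSpace ℝ (Fin N)) : ℝ≥0∞ :=
  ENNReal.ofReal (polyKernel N θ (t ^ (1 / θ)) x)

theorem measurable_heatMajorant (t : ℝ) : Measurable (heatMajorant N θ t) :=
  (measurable_polyKernel _).ennreal_ofReal

theorem heatMajorant_sub_comm (t : ℝ) (x y : ℝᴺ) :
    heatMajorant N θ t (x - y) = heatMajorant N θ t (y - x) := by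
  rw [← neg_sub, heatMajorant, polyKernel_neg, heatMajorant]

/-- Among two kernels at times `s`, `t` and points `a`, `b`, one is at most a multiple of the kernel
at time `s + t` and point `a + b`: one of the two times is comparable to `s + t`, and one of the
two points is comparable to `a + b` or longer. -/
theorem exists_min_heatMajorant_le (hθ : 0 < θ) :
    ∃ C : ℝ≥0∞, C ≠ ∞ ∧ ∀ s t : ℝ, 0 < s → 0 < t → ∀ a b : ℝᴺ,
      min (heatMajorant N θ s a) (heatMajorant N θ t b) ≤
        C * heatMajorant N θ (s + t) (a + b) := by
  set M : ℝ := (N : ℝ) + θ with hM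
  have hM0 : 0 < M := by positivity
  set κ : ℝ := 2 ^ (1 / θ) with hκ
  have hκ0 : 0 < κ := by positivity
  set L : ℝ := 4 + 2 * κ with hL
  have hL0 : 0 < L := by positivity
  refine ⟨ENNReal.ofReal (L ^ M), ENNReal.ofReal_ne_top, ?_⟩
  have hsingle : ∀ s t : ℝ, 0 < s → s ≤ t → ∀ a c : ℝᴺ,
      t ^ (1 / θ) + ‖c‖ ≤ L * (s ^ (1 / θ) + ‖a‖) →
      heatMajorant N θ s a ≤ ENNReal.ofReal (L ^ M) * heatMajorant N θ t c := by
    intro s t hs hst a c hle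
    have ht : 0 < t := hs.trans_le hst
    unfold heatMajorant polyKernel
    rw [← ENNReal.ofReal_mul (by positivity)]
    refine ENNReal.ofReal_le_ofReal ?_
    have h1 : (s ^ (1 / θ) + ‖a‖) ^ (-M) ≤ L ^ M * (t ^ (1 / θ) + ‖c‖) ^ (-M) := by
      calc (s ^ (1 / θ) + ‖a‖) ^ (-M) = L ^ M * (L * (s ^ (1 / θ) + ‖a‖)) ^ (-M) := by
            rw [Real.mul_rpow hL0.le (by positivity), ← mul_assoc, ← Real.rpow_add hL0]
            simp
        _ ≤ _ := by
            gcongr ?_ * ?_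
            exact Real.rpow_le_rpow_of_nonpos (by positivity) hle (by linarith)
    calc _ ≤ (t ^ (1 / θ)) ^ θ * (L ^ M * (t ^ (1 / θ) + ‖c‖) ^ (-M)) := by gcongr
      _ = _ := by ring
  -- by symmetry, `s` may be taken to be the longer of the two times
  have hwlog : ∀ s t : ℝ, 0 < s → 0 < t → t ≤ s → ∀ a b : ℝᴺ,
      min (heatMajorant N θ s a) (heatMajorant N θ t b) ≤
        ENNReal.ofReal (L ^ M) * heatMajorant N θ (s + t) (a + b) := by
    intro s t hs ht hts a b
    set ρ := (s + t) ^ (1 / θ) with hρ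
    have hρ0 : 0 < ρ := by positivity
    have hs1 : 0 < s ^ (1 / θ) := by positivity
    have ht1 : 0 < t ^ (1 / θ) := by positivity
    have hna := norm_nonneg a
    have hnb := norm_nonneg b
    have htri := norm_add_le a b
    rcases le_total ‖a + b‖ ρ with hc | hc
    · refine (min_le_left _ _).trans (hsingle s (s + t) hs (by linarith) a (a + b) ?_)
      have h2 : ρ ≤ κ * s ^ (1 / θ) := by
        rw [hρ, hκ, ← Real.mul_rpow (by norm_num) hs.le]
        gcongr; linarith
      rw [hL]; nlinarith
    · rcases le_total ‖b‖ ‖a‖ with hab | hab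
      · refine (min_le_left _ _).trans (hsingle s (s + t) hs (by linarith) a (a + b) ?_)
        rw [hL]; nlinarith
      · refine (min_le_right _ _).trans (hsingle t (s + t) ht (by linarith) b (a + b) ?_)
        rw [hL]; nlinarith
  intro s t hs ht a b
  rcases le_total t s with h | h
  · exact hwlog s t hs ht h a b
  · rw [min_comm, add_comm s, add_comm a]
    exact hwlog t s ht hs h b a

/-- Weighted almost-semigroup property of the comparison kernel. -/
theorem exists_lintegral_heatMajorant_mul_heatMajorant_le (hN : 1 ≤ N) (hθ : 0 < θ) (hγ : 0 < γ)
    (hγN : γ < N) : ∃ C : ℝ≥0∞, C ≠ ∞ ∧ ∀ s t : ℝ, 0 < s → 0 < t → ∀ x z : ℝᴺ,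
      ∫⁻ y, heatMajorant N θ s (x - y) * (‖y‖ₑ ^ (-γ) * heatMajorant N θ t (y - z)) ≤
        C * ENNReal.ofReal (s ^ (-(γ / θ)) + t ^ (-(γ / θ))) * heatMajorant N θ (s + t) (x - z) := by
  obtain ⟨C₁, hC₁, h₁⟩ := exists_min_heatMajorant_le (N := N) hθ
  obtain ⟨C₂, hC₂, h₂⟩ := exists_lintegral_polyKernel_mul_enorm_rpow_le (N := N) hN hθ hγ hγN
  refine ⟨C₁ * C₂, ENNReal.mul_ne_top hC₁ hC₂, fun s t hs ht x z => ?_⟩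
  set H := heatMajorant N θ (s + t) (x - z) with hH
  have hpow : ∀ r : ℝ, 0 < r → (r ^ (1 / θ)) ^ (-γ) = r ^ (-(γ / θ)) := fun r hr => by
    rw [← Real.rpow_mul hr.le]; congr 1; ring
  have hw : ∀ r : ℝ, 0 < r → ∀ v : ℝᴺ,
      ∫⁻ y, heatMajorant N θ r (v - y) * ‖y‖ₑ ^ (-γ) ≤ C₂ * ENNReal.ofReal (r ^ (-(γ / θ))) := by
    intro r hr v
    rw [← hpow r hr]
    exact h₂ _ (by positivity) v
  have hpt : ∀ y, heatMajorant N θ s (x - y) * (‖y‖ₑ ^ (-γ) * heatMajorant N θ t (y - z)) ≤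
      C₁ * H * (heatMajorant N θ s (x - y) * ‖y‖ₑ ^ (-γ) +
        heatMajorant N θ t (z - y) * ‖y‖ₑ ^ (-γ)) := by
    intro y
    have h := h₁ s t hs ht (x - y) (y - z)
    rw [sub_add_sub_cancel, ← hH] at h
    set p := heatMajorant N θ s (x - y)
    rw [heatMajorant_sub_comm t z y]
    set q := heatMajorant N θ t (y - z)
    calc p * (‖y‖ₑ ^ (-γ) * q) = min p q * max p q * ‖y‖ₑ ^ (-γ) := by
          rw [min_mul_max]; ring
      _ ≤ (C₁ * H) * (p + q) * ‖y‖ₑ ^ (-γ) := by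
          gcongr
          exact max_le (le_add_right le_rfl) (le_add_left le_rfl)
      _ = _ := by ring
  have hm : ∀ r : ℝ, ∀ v : ℝᴺ, Measurable fun y => heatMajorant N θ r (v - y) * ‖y‖ₑ ^ (-γ) :=
    fun r v => ((measurable_heatMajorant r).comp (measurable_const.sub measurable_id)).mul
      (by fun_prop)
  calc _ ≤ _ := lintegral_mono hpt
    _ = C₁ * H * ((∫⁻ y, heatMajorant N θ s (x - y) * ‖y‖ₑ ^ (-γ)) +
        ∫⁻ y, heatMajorant N θ t (z - y) * ‖y‖ₑ ^ (-γ)) := by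
      rw [← lintegral_add_left (hm s x), ← lintegral_const_mul _ (by exact (hm s x).add (hm t z))]
    _ ≤ C₁ * H * (C₂ * ENNReal.ofReal (s ^ (-(γ / θ))) + C₂ * ENNReal.ofReal (t ^ (-(γ / θ)))) := by
      gcongr
      · exact hw s hs x
      · exact hw t ht z
    _ = _ := by
      rw [ENNReal.ofReal_add (by positivity) (by positivity)]; ring

end PolyKernel

/-! ### Solutions from supersolutions -/

section Iteration

variable {N : ℕ} {θ γ p : ℝ}

local notation "ℝᴺ" => EuclideanSpace ℝ (Fin N)

theorem measurable_fracHeatKernel :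
    Measurable (fun q : ℝᴺ × ℝ => fracHeatKernel N θ q.1 q.2) := by
  simp only [fracHeatKernel, Real.fourierInv_eq']
  refine Complex.measurable_re.comp (StronglyMeasurable.measurable ?_)
  refine StronglyMeasurable.integral_prod_right (f := fun q : ℝᴺ × ℝ => fun ξ : ℝᴺ =>
    Complex.exp (((2 * Real.pi * inner ℝ ξ q.1 : ℝ) : ℂ) * Complex.I) •
      ((Real.exp (-q.2 * (2 * Real.pi * ‖ξ‖) ^ θ) : ℝ) : ℂ)) ?_
  refine Measurable.stronglyMeasurable ?_
  simp only [Function.uncurry_def]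
  fun_prop

/-- The right-hand side of the integral equation, as a map acting on `u`. -/
noncomputable def duhamelMap (N : ℕ) (θ γ p : ℝ) (μ : Measure (EuclideanSpace ℝ (Fin N)))
    (u : EuclideanSpace ℝ (Fin N) × ℝ → ℝ≥0∞) (q : EuclideanSpace ℝ (Fin N) × ℝ) : ℝ≥0∞ :=
  fracHeatSemigroup N θ q.2 μ q.1 +
    ∫⁻ s in Ioo 0 q.2, ∫⁻ y,
      ENNReal.ofReal (fracHeatKernel N θ (q.1 - y) (q.2 - s)) * (‖y‖ₑ ^ (-γ) * u (y, s) ^ p)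

theorem measurable_duhamel_integrand {u : ℝᴺ × ℝ → ℝ≥0∞} (hu : Measurable u) :
    Measurable (fun z : ((ℝᴺ × ℝ) × ℝ) × ℝᴺ =>
      ENNReal.ofReal (fracHeatKernel N θ (z.1.1.1 - z.2) (z.1.1.2 - z.1.2)) *
        (‖z.2‖ₑ ^ (-γ) * u (z.2, z.1.2) ^ p)) := by
  have h1 : Measurable (fun z : ((ℝᴺ × ℝ) × ℝ) × ℝᴺ =>
      fracHeatKernel N θ (z.1.1.1 - z.2) (z.1.1.2 - z.1.2)) :=
    measurable_fracHeatKernel.comp (f := fun z : ((ℝᴺ × ℝ) × ℝ) × ℝᴺ =>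
      (z.1.1.1 - z.2, z.1.1.2 - z.1.2)) (by fun_prop)
  have h2 : Measurable (fun z : ((ℝᴺ × ℝ) × ℝ) × ℝᴺ => u (z.2, z.1.2)) :=
    hu.comp (by fun_prop)
  exact h1.ennreal_ofReal.mul ((by fun_prop : Measurable fun z : ((ℝᴺ × ℝ) × ℝ) × ℝᴺ =>
    ‖z.2‖ₑ ^ (-γ)).mul (h2.pow_const p))

theorem measurable_duhamelMap (μ : Measure ℝᴺ) [SFinite μ] {u : ℝᴺ × ℝ → ℝ≥0∞}
    (hu : Measurable u) : Measurable (duhamelMap N θ γ p μ u) := by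
  refine Measurable.add ?_ ?_
  · have h : Measurable (fun z : (ℝᴺ × ℝ) × ℝᴺ =>
        ENNReal.ofReal (fracHeatKernel N θ (z.1.1 - z.2) z.1.2)) :=
      (measurable_fracHeatKernel.comp (f := fun z : (ℝᴺ × ℝ) × ℝᴺ =>
        (z.1.1 - z.2, z.1.2)) (by fun_prop)).ennreal_ofReal
    exact h.lintegral_prod_right'
  · have h := (measurable_duhamel_integrand (θ := θ) (γ := γ) (p := p) hu).lintegral_prod_right'
      (ν := volume)
    have hset : MeasurableSet {z : (ℝᴺ × ℝ) × ℝ | z.2 ∈ Ioo 0 z.1.2} := by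
      simp only [mem_Ioo]
      measurability
    convert (h.indicator hset).lintegral_prod_right' (ν := volume) using 2 with q
    rw [← lintegral_indicator measurableSet_Ioo]
    rfl

theorem duhamelMap_mono (hp : 0 ≤ p) (μ : Measure ℝᴺ) : Monotone (duhamelMap N θ γ p μ) := by
  intro u v huv q
  unfold duhamelMap
  gcongr with s y
  exact huv _

/-- Monotone convergence for an iterated integral. -/
theorem lintegral_lintegral_iSup {α β : Type*} [MeasurableSpace α] [MeasurableSpace β]
    {μ : Measure α} {ν : Measure β} [SFinite ν] {f : ℕ → α × β → ℝ≥0∞}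
    (hf : ∀ n, Measurable (f n)) (hmono : Monotone f) :
    ∫⁻ a, ∫⁻ b, ⨆ n, f n (a, b) ∂ν ∂μ = ⨆ n, ∫⁻ a, ∫⁻ b, f n (a, b) ∂ν ∂μ := by
  rw [← lintegral_iSup (fun n => (hf n).lintegral_prod_right')
    (fun m n hmn a => lintegral_mono fun b => hmono hmn _)]
  refine lintegral_congr fun a => ?_
  exact lintegral_iSup (f := fun n b => f n (a, b))
    (fun n => (hf n).comp measurable_prodMk_left) (fun m n hmn b => hmono hmn _)

theorem duhamelMap_iSup (hp : 0 < p) (μ : Measure ℝᴺ) {u : ℕ → ℝᴺ × ℝ → ℝ≥0∞}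
    (hu : ∀ n, Measurable (u n)) (hmono : Monotone u) (q : ℝᴺ × ℝ) :
    duhamelMap N θ γ p μ (⨆ n, u n) q = ⨆ n, duhamelMap N θ γ p μ (u n) q := by
  have hm : ∀ n, Measurable (fun z : ℝ × ℝᴺ =>
      ENNReal.ofReal (fracHeatKernel N θ (q.1 - z.2) (q.2 - z.1)) *
        (‖z.2‖ₑ ^ (-γ) * u n (z.2, z.1) ^ p)) := fun n =>
    (measurable_duhamel_integrand (θ := θ) (γ := γ) (p := p) (hu n)).comp
      (f := fun z : ℝ × ℝᴺ => ((q, z.1), z.2)) (by fun_prop)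
  have hsup : ∀ (s : ℝ) (y : ℝᴺ), ENNReal.ofReal (fracHeatKernel N θ (q.1 - y) (q.2 - s)) *
      (‖y‖ₑ ^ (-γ) * (⨆ n, u n) (y, s) ^ p) =
      ⨆ n, ENNReal.ofReal (fracHeatKernel N θ (q.1 - y) (q.2 - s)) *
        (‖y‖ₑ ^ (-γ) * u n (y, s) ^ p) := by
    intro s y
    have h := (ENNReal.orderIsoRpow p hp).map_iSup (fun n => u n (y, s))
    simp only [ENNReal.orderIsoRpow_apply] at h
    rw [iSup_apply, h, ENNReal.mul_iSup, ENNReal.mul_iSup]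
  simp only [duhamelMap, hsup]
  rw [← ENNReal.add_iSup]
  congr 1
  exact lintegral_lintegral_iSup hm fun m n hmn z =>
    mul_le_mul_right (mul_le_mul_right (ENNReal.rpow_le_rpow (hmono hmn _) hp.le) _) _

theorem measurableSet_spaceTime (T : ℝ≥0∞) : MeasurableSet (spaceTime N T) := by
  unfold spaceTime
  measurability

/-- Monotone iteration started at `0` stays below a finite supersolution and converges to a
solution. Only the measurability of the kernel is used. -/
theorem exists_isHardySolution_of_duhamelMap_le (hp : 0 < p) (μ : Measure ℝᴺ) [SFinite μ]
    {T : ℝ≥0∞} {w : ℝᴺ × ℝ → ℝ≥0∞} (hfin : ∀ q ∈ spaceTime N T, w q < ∞)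
    (hw : ∀ q ∈ spaceTime N T, duhamelMap N θ γ p μ w q ≤ w q) :
    ∃ u : ℝᴺ × ℝ → ℝ≥0∞, IsHardySolution N θ γ p μ T u := by
  set Φ := duhamelMap N θ γ p μ with hΦ
  set u : ℕ → ℝᴺ × ℝ → ℝ≥0∞ := fun n => Φ^[n] 0 with hu
  have hsucc : ∀ n, u (n + 1) = Φ (u n) := fun n => Function.iterate_succ_apply' Φ n 0
  have hmeas : ∀ n, Measurable (u n) := by
    intro n
    induction n with
    | zero => exact measurable_const
    | succ n ih => rw [hsucc]; exact measurable_duhamelMap μ ih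
  have hmono : Monotone u :=
    (duhamelMap_mono hp.le μ).monotone_iterate_of_le_map (fun q => zero_le (a := Φ 0 q))
  have hle : ∀ n, ∀ q ∈ spaceTime N T, u n q ≤ w q := by
    intro n
    induction n with
    | zero => exact fun q _ => by simp [hu]
    | succ n ih =>
      intro q hq
      rw [hsucc]
      refine le_trans ?_ (hw q hq)
      simp only [hΦ, duhamelMap]
      refine add_le_add_right ?_ _
      refine setLIntegral_mono' measurableSet_Ioo fun s hs => ?_
      gcongr with y
      exact ih (y, s) ⟨hs.1, (ENNReal.ofReal_le_ofReal hs.2.le).trans_lt hq.2⟩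
  have hfix : ∀ q, (⨆ n, u n) q = Φ (⨆ n, u n) q := by
    intro q
    rw [hΦ, duhamelMap_iSup hp μ hmeas hmono, iSup_apply,
      ← (show Monotone fun n => u n q from fun m n h => hmono h q).iSup_nat_add 1]
    simp only [hsucc, hΦ]
  refine ⟨⨆ n, u n, ⟨Measurable.aemeasurable ?_, ?_, ?_⟩⟩
  · rw [show (⨆ n, u n) = fun q => ⨆ n, u n q from funext fun q => iSup_apply]
    exact Measurable.iSup hmeas
  · refine ae_restrict_of_forall_mem (measurableSet_spaceTime T) fun q hq => ?_
    rw [iSup_apply]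
    exact (iSup_le fun n => hle n q hq).trans_lt (hfin q hq)
  · exact Filter.Eventually.of_forall hfix

end Iteration

/-! ### The supersolution -/

theorem lintegral_Ioo_ofReal_rpow_neg {e t : ℝ} (he : e < 1) (ht : 0 < t) :
    ∫⁻ s in Ioo 0 t, ENNReal.ofReal (s ^ (-e)) = ENNReal.ofReal (t ^ (1 - e) / (1 - e)) := by
  have hint : IntegrableOn (fun s : ℝ => s ^ (-e)) (Ioo 0 t) :=
    (intervalIntegral.integrableOn_Ioo_rpow_iff ht).2 (by linarith)
  rw [← ofReal_integral_eq_lintegral_ofReal hint]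
  · congr 1
    rw [← integral_Ioc_eq_integral_Ioo, ← intervalIntegral.integral_of_le ht.le,
      integral_rpow (Or.inl (by linarith)), Real.zero_rpow (by linarith), neg_add_eq_sub, sub_zero]
  · exact (ae_restrict_iff' measurableSet_Ioo).2
      (Filter.Eventually.of_forall fun s hs => Real.rpow_nonneg hs.1.le _)

theorem lintegral_Ioo_comp_sub_left (g : ℝ → ℝ≥0∞) (t : ℝ) :
    ∫⁻ s in Ioo 0 t, g (t - s) = ∫⁻ s in Ioo 0 t, g s := by
  rw [← lintegral_indicator measurableSet_Ioo, ← lintegral_indicator measurableSet_Ioo,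
    ← lintegral_sub_left_eq_self (fun s => (Ioo 0 t).indicator g s) t]
  refine lintegral_congr fun s => ?_
  simp only [indicator, mem_Ioo, sub_pos, sub_lt_self_iff]
  simp only [and_comm]

theorem rpow_neg_mul_rpow_neg_le {a b s t : ℝ} (ha : 0 ≤ a) (hb : 0 ≤ b) (hs : 0 < s)
    (ht : 0 < t) : s ^ (-a) * t ^ (-b) ≤ s ^ (-(a + b)) + t ^ (-(a + b)) := by
  rcases le_total s t with h | h
  · calc s ^ (-a) * t ^ (-b) ≤ s ^ (-a) * s ^ (-b) := by
          gcongr ?_ * ?_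
          exact Real.rpow_le_rpow_of_nonpos hs h (by linarith)
      _ = s ^ (-(a + b)) := by rw [← Real.rpow_add hs]; congr 1; ring
      _ ≤ _ := le_add_of_nonneg_right (by positivity)
  · calc s ^ (-a) * t ^ (-b) ≤ t ^ (-a) * t ^ (-b) := by
          gcongr ?_ * ?_
          exact Real.rpow_le_rpow_of_nonpos ht h (by linarith)
      _ = t ^ (-(a + b)) := by rw [← Real.rpow_add ht]; congr 1; ring
      _ ≤ _ := le_add_of_nonneg_left (by positivity)

theorem lintegral_Ioo_rpow_neg_mul_le {a b t : ℝ} (ha : 0 ≤ a) (hb : 0 ≤ b) (hab : a + b < 1)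
    (ht : 0 < t) :
    ∫⁻ s in Ioo 0 t, ENNReal.ofReal (s ^ (-a)) * ENNReal.ofReal ((t - s) ^ (-b) + s ^ (-b)) ≤
      ENNReal.ofReal (3 / (1 - (a + b))) * ENNReal.ofReal (t ^ (1 - (a + b))) := by
  set e := a + b with he
  have hpt : ∀ s ∈ Ioo 0 t,
      ENNReal.ofReal (s ^ (-a)) * ENNReal.ofReal ((t - s) ^ (-b) + s ^ (-b)) ≤
        2 * ENNReal.ofReal (s ^ (-e)) + ENNReal.ofReal ((t - s) ^ (-e)) := by
    intro s hs
    have hs0 : 0 < s := hs.1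
    have hts : 0 < t - s := sub_pos.2 hs.2
    rw [← ENNReal.ofReal_mul (by positivity), show (2 : ℝ≥0∞) = ENNReal.ofReal 2 by simp,
      ← ENNReal.ofReal_mul (by norm_num), ← ENNReal.ofReal_add (by positivity) (by positivity)]
    refine ENNReal.ofReal_le_ofReal ?_
    have h1 := rpow_neg_mul_rpow_neg_le ha hb hs0 hts
    have h2 : s ^ (-a) * s ^ (-b) = s ^ (-e) := by
      rw [← Real.rpow_add hs0, he]; congr 1; ring
    rw [← he] at h1
    linarith
  have hm : Measurable fun s : ℝ => ENNReal.ofReal (s ^ (-e)) := by fun_prop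
  calc _ ≤ ∫⁻ s in Ioo 0 t, (2 * ENNReal.ofReal (s ^ (-e)) + ENNReal.ofReal ((t - s) ^ (-e))) :=
        setLIntegral_mono' measurableSet_Ioo hpt
    _ = 2 * ENNReal.ofReal (t ^ (1 - e) / (1 - e)) + ENNReal.ofReal (t ^ (1 - e) / (1 - e)) := by
      rw [lintegral_add_left (hm.const_mul 2), lintegral_const_mul _ hm,
        lintegral_Ioo_comp_sub_left (fun s => ENNReal.ofReal (s ^ (-e))),
        lintegral_Ioo_ofReal_rpow_neg hab ht]
    _ = _ := by
      have : 0 < 1 - e := by linarith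
      rw [← ENNReal.ofReal_mul (by positivity), div_mul_eq_mul_div, mul_div_assoc,
        ENNReal.ofReal_mul (by norm_num), show ENNReal.ofReal 3 = 3 by simp]
      ring

section Supersolution

variable {N : ℕ} {θ γ p : ℝ}

local notation "ℝᴺ" => EuclideanSpace ℝ (Fin N)

/-- Hölder's inequality for a kernel `k` of finite mass. -/
theorem lintegral_mul_le_rpow_mul_rpow {α : Type*} [MeasurableSpace α] {μ : Measure α} {s : ℝ}
    (hs : 1 < s) {k f : α → ℝ≥0∞} (hk : Measurable k) (hf : Measurable f) :
    ∫⁻ y, k y * f y ∂μ ≤ (∫⁻ y, k y ∂μ) ^ (1 - 1 / s) * (∫⁻ y, k y * f y ^ s ∂μ) ^ (1 / s) := by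
  have hs0 : 0 < s := by linarith
  have h1s : 0 < 1 - 1 / s := by rw [sub_pos, div_lt_one hs0]; exact hs
  have hconj : (s.conjExponent).HolderConjugate s := (Real.HolderConjugate.conjExponent hs).symm
  have hq : 1 / s.conjExponent = 1 - 1 / s := by
    rw [Real.conjExponent]; field_simp
  have h := ENNReal.lintegral_mul_le_Lp_mul_Lq μ hconj
    (f := fun y => k y ^ (1 - 1 / s)) (g := fun y => k y ^ (1 / s) * f y)
    (by fun_prop) (by fun_prop)
  refine le_trans (le_of_eq ?_) (h.trans (le_of_eq ?_))
  · refine lintegral_congr fun y => ?_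
    rw [Pi.mul_apply, ← mul_assoc, ← ENNReal.rpow_add_of_nonneg _ _ h1s.le (by positivity)]
    simp
  · rw [hq]
    congr 2
    · refine lintegral_congr fun y => ?_
      rw [← ENNReal.rpow_mul, ← hq, one_div_mul_cancel hconj.ne_zero, ENNReal.rpow_one]
    · refine lintegral_congr fun y => ?_
      rw [ENNReal.mul_rpow_of_nonneg _ _ hs0.le, ← ENNReal.rpow_mul, one_div_mul_cancel hs0.ne',
        ENNReal.rpow_one]

/-- The convolution of `f ^ s` with the majorant of the fundamental solution. -/
noncomputable def heatPotential (N : ℕ) (θ s : ℝ) (f : EuclideanSpace ℝ (Fin N) → ℝ≥0∞)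
    (q : EuclideanSpace ℝ (Fin N) × ℝ) : ℝ≥0∞ :=
  ∫⁻ z, heatMajorant N θ q.2 (q.1 - z) * f z ^ s

/-- Integrating the potential against the weighted kernel costs only a power of time. -/
theorem exists_lintegral_heatMajorant_mul_heatPotential_le (hN : 1 ≤ N) (hθ : 0 < θ) (hγ : 0 < γ)
    (hγN : γ < N) (s : ℝ) : ∃ C : ℝ≥0∞, C ≠ ∞ ∧ ∀ f : ℝᴺ → ℝ≥0∞, Measurable f →
      ∀ t τ : ℝ, 0 < τ → τ < t → ∀ x : ℝᴺ,
      ∫⁻ y, heatMajorant N θ (t - τ) (x - y) * (‖y‖ₑ ^ (-γ) * heatPotential N θ s f (y, τ)) ≤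
        C * ENNReal.ofReal ((t - τ) ^ (-(γ / θ)) + τ ^ (-(γ / θ))) *
          heatPotential N θ s f (x, t) := by
  obtain ⟨C, hC, h⟩ := exists_lintegral_heatMajorant_mul_heatMajorant_le (N := N) hN hθ hγ hγN
  refine ⟨C, hC, fun f hf t τ hτ hτt x => ?_⟩
  have hm2 : ∀ r : ℝ, Measurable fun q : ℝᴺ × ℝᴺ => heatMajorant N θ r (q.1 - q.2) := fun r =>
    (measurable_heatMajorant r).comp (by fun_prop)
  have hm1 : ∀ (r : ℝ) (v : ℝᴺ), Measurable fun y : ℝᴺ => heatMajorant N θ r (v - y) :=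
    fun r v => (measurable_heatMajorant r).comp (by fun_prop)
  have hm3 : ∀ (r : ℝ) (v : ℝᴺ), Measurable fun y : ℝᴺ => heatMajorant N θ r (y - v) :=
    fun r v => (measurable_heatMajorant r).comp (by fun_prop)
  have hfs : Measurable fun z => f z ^ s := hf.pow_const s
  have hw : Measurable fun y : ℝᴺ => ‖y‖ₑ ^ (-γ) := by fun_prop
  calc ∫⁻ y, heatMajorant N θ (t - τ) (x - y) * (‖y‖ₑ ^ (-γ) * heatPotential N θ s f (y, τ))
      = ∫⁻ y, ∫⁻ z, heatMajorant N θ (t - τ) (x - y) *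
          (‖y‖ₑ ^ (-γ) * heatMajorant N θ τ (y - z)) * f z ^ s := by
        refine lintegral_congr fun y => ?_
        simp only [heatPotential]
        rw [← lintegral_const_mul _ (by exact (hm1 τ y).mul hfs),
          ← lintegral_const_mul _ (by exact ((hm1 τ y).mul hfs).const_mul _)]
        refine lintegral_congr fun z => ?_
        ring
    _ = ∫⁻ z, ∫⁻ y, heatMajorant N θ (t - τ) (x - y) *
          (‖y‖ₑ ^ (-γ) * heatMajorant N θ τ (y - z)) * f z ^ s := by
        refine lintegral_lintegral_swap (Measurable.aemeasurable ?_)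
        exact (((hm1 (t - τ) x).comp measurable_fst).mul
          ((hw.comp measurable_fst).mul (hm2 τ))).mul (hfs.comp measurable_snd)
    _ ≤ ∫⁻ z, C * ENNReal.ofReal ((t - τ) ^ (-(γ / θ)) + τ ^ (-(γ / θ))) *
          (heatMajorant N θ t (x - z) * f z ^ s) := by
        refine lintegral_mono fun z => ?_
        rw [lintegral_mul_const _ (by exact (hm1 (t - τ) x).mul (hw.mul (hm3 τ z))), ← mul_assoc]
        have := h (t - τ) τ (sub_pos.2 hτt) hτ x z
        rw [sub_add_cancel] at this
        exact mul_le_mul_left this _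
    _ = _ := by rw [lintegral_const_mul _ (by exact (hm1 t x).mul hfs), heatPotential]

theorem exists_ofReal_fracHeatKernel_le_heatMajorant (hN : 1 ≤ N) (hθ : 0 < θ) (hθ2 : θ ≤ 2) :
    ∃ C : ℝ≥0∞, C ≠ ∞ ∧ ∀ t : ℝ, 0 < t → ∀ x : ℝᴺ,
      ENNReal.ofReal (fracHeatKernel N θ x t) ≤ C * heatMajorant N θ t x := by
  obtain ⟨C, hC, h⟩ := exists_abs_fracHeatKernel_le_polyKernel (N := N) hN hθ hθ2
  refine ⟨ENNReal.ofReal C, ENNReal.ofReal_ne_top, fun t ht x => ?_⟩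
  rw [heatMajorant, ← ENNReal.ofReal_mul hC]
  exact ENNReal.ofReal_le_ofReal ((le_abs_self _).trans (h t ht x))

/-- If the averages of `f ^ s` obey the critical Morrey bound with a small constant `C₃`, then
`c U^{1/s}` is a supersolution, where `U` is the heat potential of `f ^ s`. Also records the bound
`U ≤ B (C₃ t^{-β})^s`, `β = (θ - γ) / (θ (p - 1))`. It is used twice: to linearise `U^{p/s}` as a
power of time multiplied by `U`, and to write `U` as a power of time multiplied by `U^{1/s}`. The
powers of time cancel because the Morrey scale is the critical one. -/
theorem exists_duhamelMap_heatPotential_le (hN : 1 ≤ N) (hθ : 0 < θ) (hθ2 : θ ≤ 2) (hγ : 0 < γ)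
    (hγθ : γ < θ) (hγN : γ < N) {s : ℝ} (hs : 1 < s) (hsp : s < p) :
    ∃ c D : ℝ≥0∞, c ≠ ∞ ∧ D ≠ ∞ ∧ ∃ B : ℝ≥0∞, B ≠ ∞ ∧ ∀ C₃ : ℝ, 0 < C₃ →
      D * ENNReal.ofReal (C₃ ^ (p - 1)) ≤ 1 → ∀ T : ℝ≥0∞, ∀ f : ℝᴺ → ℝ≥0∞, Measurable f →
      (∀ t : ℝ, 0 < t → ENNReal.ofReal t < T → ∀ z : ℝᴺ,
        ∫⁻ y in Metric.ball z (t ^ (1 / θ)), f y ^ s ≤ volume (Metric.ball z (t ^ (1 / θ))) *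
          ENNReal.ofReal (C₃ * t ^ (-((θ - γ) / (p - 1) / θ))) ^ s) →
      ∀ q ∈ spaceTime N T,
        heatPotential N θ s f q ≤
          B * ENNReal.ofReal (C₃ * q.2 ^ (-((θ - γ) / (p - 1) / θ))) ^ s ∧
        duhamelMap N θ γ p (volume.withDensity f)
          (fun q => c * heatPotential N θ s f q ^ (1 / s)) q ≤
            c * heatPotential N θ s f q ^ (1 / s) := by
  have hs0 : 0 < s := by linarith
  have hp1 : 0 < p - 1 := by linarith
  have hps : 0 < p - s := by linarith
  obtain ⟨C₀, hC₀, hK⟩ := exists_ofReal_fracHeatKernel_le_heatMajorant (N := N) hN hθ hθ2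
  obtain ⟨B, hB, hBU⟩ := exists_lintegral_polyKernel_mul_le_of_average_le (N := N) hθ
  obtain ⟨C₁, hC₁, hP⟩ :=
    exists_lintegral_heatMajorant_mul_heatPotential_le (N := N) hN hθ hγ hγN s
  set I := ∫⁻ y : ℝᴺ, ENNReal.ofReal (polyKernel N θ 1 y) with hI
  have hIt : I ≠ ∞ := lintegral_polyKernel_one_ne_top hθ
  set β := (θ - γ) / (p - 1) / θ with hβ
  have hβ0 : 0 < β := by
    have : 0 < θ - γ := by linarith
    positivity
  have hβp : β * (p - 1) = 1 - γ / θ := by rw [hβ]; field_simp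
  have h1s : 0 < 1 - 1 / s := by rw [sub_pos, div_lt_one hs0]; exact hs
  have hps1 : 0 < p / s - 1 := by rw [sub_pos, one_lt_div hs0]; exact hsp
  -- `τ^{-a}` bounds `U^{p/s-1}` and `τ^{-b}` is the cost of the weight; `a + b < 1` is `1 < s`
  set a := β * (p - s) with ha
  set b := γ / θ with hb
  have ha0 : 0 ≤ a := by positivity
  have hb0 : 0 ≤ b := by positivity
  have hab : a + b < 1 := by
    have : β * (p - 1) = a + β * (s - 1) := by rw [ha]; ring
    nlinarith [mul_pos hβ0 (sub_pos.2 hs)]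
  -- the linear part takes `C₀ I^{1-1/s}` of the coefficient `c`, which leaves
  -- `1` for the nonlinear part
  set c := C₀ * I ^ (1 - 1 / s) + 1 with hc
  have hct : c ≠ ∞ := ENNReal.add_ne_top.2
    ⟨ENNReal.mul_ne_top hC₀ (ENNReal.rpow_ne_top_of_nonneg h1s.le hIt), ENNReal.one_ne_top⟩
  set F := C₀ * c ^ p * B ^ (p / s - 1) * C₁ with hF
  have hFt : F ≠ ∞ := by
    refine ENNReal.mul_ne_top (ENNReal.mul_ne_top (ENNReal.mul_ne_top hC₀ ?_) ?_) hC₁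
    · exact ENNReal.rpow_ne_top_of_nonneg (by linarith) hct
    · exact ENNReal.rpow_ne_top_of_nonneg hps1.le hB
  refine ⟨c, F * ENNReal.ofReal (3 / (1 - (a + b))) * B ^ (1 - 1 / s), hct,
    ENNReal.mul_ne_top (ENNReal.mul_ne_top hFt ENNReal.ofReal_ne_top)
      (ENNReal.rpow_ne_top_of_nonneg h1s.le hB), B, hB, ?_⟩
  intro C₃ hC₃ hsmall T f hf hM
  set U := heatPotential N θ s f with hU
  have hUb : ∀ y : ℝᴺ, ∀ t : ℝ, 0 < t → ENNReal.ofReal t < T →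
      U (y, t) ≤ B * ENNReal.ofReal (C₃ * t ^ (-β)) ^ s := fun y t ht htT =>
    hBU _ (by positivity) _ (hf.pow_const s) _ (hM t ht htT) y
  rintro ⟨x, t⟩ ⟨ht : 0 < t, htT : ENNReal.ofReal t < T⟩
  refine ⟨hUb x t ht htT, ?_⟩
  have hmQ : ∀ (r : ℝ) (v : ℝᴺ), Measurable fun y : ℝᴺ => heatMajorant N θ r (v - y) :=
    fun r v => (measurable_heatMajorant r).comp (by fun_prop)
  have hlin : fracHeatSemigroup N θ t (volume.withDensity f) x ≤
      C₀ * I ^ (1 - 1 / s) * U (x, t) ^ (1 / s) := by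
    have hmK : Measurable fun y : ℝᴺ => ENNReal.ofReal (fracHeatKernel N θ (x - y) t) :=
      (measurable_fracHeatKernel.comp (f := fun y : ℝᴺ => (x - y, t))
        (by fun_prop)).ennreal_ofReal
    calc fracHeatSemigroup N θ t (volume.withDensity f) x
        = ∫⁻ y, ENNReal.ofReal (fracHeatKernel N θ (x - y) t) * f y := by
          rw [fracHeatSemigroup, lintegral_withDensity_eq_lintegral_mul _ hf hmK]
          refine lintegral_congr fun y => ?_
          rw [Pi.mul_apply, mul_comm]
      _ ≤ ∫⁻ y, C₀ * (heatMajorant N θ t (x - y) * f y) := by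
          refine lintegral_mono fun y => ?_
          rw [← mul_assoc]
          exact mul_le_mul_left (hK t ht _) _
      _ = C₀ * ∫⁻ y, heatMajorant N θ t (x - y) * f y :=
          lintegral_const_mul _ ((hmQ t x).mul hf)
      _ ≤ C₀ * (I ^ (1 - 1 / s) * U (x, t) ^ (1 / s)) := by
          gcongr
          refine (lintegral_mul_le_rpow_mul_rpow hs (hmQ t x) hf).trans_eq ?_
          simp only [heatMajorant]
          rw [lintegral_polyKernel (by positivity)]
          rfl
      _ = _ := by ring
  have hpow : ∀ y : ℝᴺ, ∀ τ : ℝ, 0 < τ → τ < t → (c * U (y, τ) ^ (1 / s)) ^ p ≤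
      c ^ p * B ^ (p / s - 1) * ENNReal.ofReal (C₃ ^ (p - s) * τ ^ (-a)) * U (y, τ) := by
    intro y τ hτ hτt
    have h1 := hUb y τ hτ ((ENNReal.ofReal_le_ofReal hτt.le).trans_lt htT)
    have h2 : U (y, τ) ^ (p / s) ≤
        B ^ (p / s - 1) * ENNReal.ofReal (C₃ ^ (p - s) * τ ^ (-a)) * U (y, τ) := by
      calc U (y, τ) ^ (p / s) = U (y, τ) ^ (p / s - 1) * U (y, τ) := by
            conv_rhs => rw [← ENNReal.rpow_one (U (y, τ)), ← ENNReal.rpow_mul,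
              ← ENNReal.rpow_add_of_nonneg _ _ (by linarith) zero_le_one]
            congr 1; ring
        _ ≤ (B * ENNReal.ofReal (C₃ * τ ^ (-β)) ^ s) ^ (p / s - 1) * U (y, τ) := by
            gcongr
        _ = _ := by
            rw [ENNReal.mul_rpow_of_nonneg _ _ hps1.le, ← ENNReal.rpow_mul,
              show s * (p / s - 1) = p - s by field_simp, ENNReal.ofReal_rpow_of_pos (by positivity),
              Real.mul_rpow hC₃.le (by positivity), ← Real.rpow_mul hτ.le, ha]
            congr 5; ring
    rw [ENNReal.mul_rpow_of_nonneg _ _ (by linarith), ← ENNReal.rpow_mul, one_div_mul_eq_div]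
    calc c ^ p * U (y, τ) ^ (p / s) ≤ c ^ p * _ := mul_le_mul_right h2 _
      _ = _ := by ring
  have hinner : ∀ τ ∈ Ioo 0 t, ∫⁻ y, ENNReal.ofReal (fracHeatKernel N θ (x - y) (t - τ)) *
      (‖y‖ₑ ^ (-γ) * (c * U (y, τ) ^ (1 / s)) ^ p) ≤
      F * ENNReal.ofReal (C₃ ^ (p - s)) * U (x, t) *
        (ENNReal.ofReal (τ ^ (-a)) * ENNReal.ofReal ((t - τ) ^ (-b) + τ ^ (-b))) := by
    rintro τ ⟨hτ, hτt⟩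
    set m := c ^ p * B ^ (p / s - 1) * ENNReal.ofReal (C₃ ^ (p - s) * τ ^ (-a)) with hm
    have hmt : m ≠ ∞ := by
      refine ENNReal.mul_ne_top (ENNReal.mul_ne_top ?_ ?_) ENNReal.ofReal_ne_top
      · exact ENNReal.rpow_ne_top_of_nonneg (by linarith) hct
      · exact ENNReal.rpow_ne_top_of_nonneg hps1.le hB
    calc _ ≤ ∫⁻ y, C₀ * m * (heatMajorant N θ (t - τ) (x - y) * (‖y‖ₑ ^ (-γ) * U (y, τ))) := by
          refine lintegral_mono fun y => ?_
          calc _ ≤ C₀ * heatMajorant N θ (t - τ) (x - y) * (‖y‖ₑ ^ (-γ) * (m * U (y, τ))) := by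
                refine mul_le_mul' (hK _ (sub_pos.2 hτt) _) ?_
                gcongr
                exact hpow y τ hτ hτt
            _ = _ := by ring
      _ = C₀ * m * ∫⁻ y, heatMajorant N θ (t - τ) (x - y) * (‖y‖ₑ ^ (-γ) * U (y, τ)) :=
          lintegral_const_mul' _ _ (ENNReal.mul_ne_top hC₀ hmt)
      _ ≤ C₀ * m * (C₁ * ENNReal.ofReal ((t - τ) ^ (-b) + τ ^ (-b)) * U (x, t)) := by
          gcongr
          exact hP f hf t τ hτ hτt x
      _ = _ := by
          rw [hm, hF, ENNReal.ofReal_mul (by positivity)]; ring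
  have hUfin : U (x, t) ≠ ∞ := ne_top_of_le_ne_top
    (ENNReal.mul_ne_top hB (ENNReal.rpow_ne_top_of_nonneg hs0.le ENNReal.ofReal_ne_top))
    (hUb x t ht htT)
  have hUt : U (x, t) ≤ B ^ (1 - 1 / s) * ENNReal.ofReal (C₃ ^ (s - 1) * t ^ (-(β * (s - 1)))) *
      U (x, t) ^ (1 / s) := by
    calc U (x, t) = U (x, t) ^ (1 - 1 / s) * U (x, t) ^ (1 / s) := by
          rw [← ENNReal.rpow_add_of_nonneg _ _ h1s.le (by positivity)]; simp
      _ ≤ (B * ENNReal.ofReal (C₃ * t ^ (-β)) ^ s) ^ (1 - 1 / s) * U (x, t) ^ (1 / s) := by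
          gcongr; exact hUb x t ht htT
      _ = _ := by
          rw [ENNReal.mul_rpow_of_nonneg _ _ h1s.le, ← ENNReal.rpow_mul,
            show s * (1 - 1 / s) = s - 1 by field_simp, ENNReal.ofReal_rpow_of_pos (by positivity),
            Real.mul_rpow hC₃.le (by positivity), ← Real.rpow_mul ht.le]
          congr 5; ring
  have htime : C₃ ^ (p - s) * t ^ (1 - (a + b)) * (C₃ ^ (s - 1) * t ^ (-(β * (s - 1)))) =
      C₃ ^ (p - 1) := by
    have h1 : t ^ (1 - (a + b)) * t ^ (-(β * (s - 1))) = 1 := by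
      rw [← Real.rpow_add ht]
      have : 1 - (a + b) + -(β * (s - 1)) = 0 := by
        have : β * (p - 1) = a + β * (s - 1) := by rw [ha]; ring
        linarith
      rw [this, Real.rpow_zero]
    have h2 : C₃ ^ (p - s) * C₃ ^ (s - 1) = C₃ ^ (p - 1) := by
      rw [← Real.rpow_add hC₃]; congr 1; ring
    calc _ = (C₃ ^ (p - s) * C₃ ^ (s - 1)) * (t ^ (1 - (a + b)) * t ^ (-(β * (s - 1)))) := by ring
      _ = _ := by rw [h1, h2, mul_one]
  have hnonlin : ∫⁻ τ in Ioo 0 t, ∫⁻ y, ENNReal.ofReal (fracHeatKernel N θ (x - y) (t - τ)) *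
      (‖y‖ₑ ^ (-γ) * (c * U (y, τ) ^ (1 / s)) ^ p) ≤ 1 * U (x, t) ^ (1 / s) := by
    set J := ENNReal.ofReal (3 / (1 - (a + b))) with hJ
    calc _ ≤ ∫⁻ τ in Ioo 0 t, F * ENNReal.ofReal (C₃ ^ (p - s)) * U (x, t) *
        (ENNReal.ofReal (τ ^ (-a)) * ENNReal.ofReal ((t - τ) ^ (-b) + τ ^ (-b))) :=
          setLIntegral_mono' measurableSet_Ioo hinner
      _ = F * ENNReal.ofReal (C₃ ^ (p - s)) * U (x, t) * ∫⁻ τ in Ioo 0 t,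
        (ENNReal.ofReal (τ ^ (-a)) * ENNReal.ofReal ((t - τ) ^ (-b) + τ ^ (-b))) :=
          lintegral_const_mul' _ _ (ENNReal.mul_ne_top
            (ENNReal.mul_ne_top hFt ENNReal.ofReal_ne_top) hUfin)
      _ ≤ F * ENNReal.ofReal (C₃ ^ (p - s)) *
          (B ^ (1 - 1 / s) * ENNReal.ofReal (C₃ ^ (s - 1) * t ^ (-(β * (s - 1)))) *
            U (x, t) ^ (1 / s)) * (J * ENNReal.ofReal (t ^ (1 - (a + b)))) := by
          gcongr
          exact lintegral_Ioo_rpow_neg_mul_le ha0 hb0 hab ht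
      _ = F * J * B ^ (1 - 1 / s) * (ENNReal.ofReal (C₃ ^ (p - s)) *
          ENNReal.ofReal (t ^ (1 - (a + b))) *
            ENNReal.ofReal (C₃ ^ (s - 1) * t ^ (-(β * (s - 1))))) * U (x, t) ^ (1 / s) := by ring
      _ = F * J * B ^ (1 - 1 / s) * ENNReal.ofReal (C₃ ^ (p - 1)) * U (x, t) ^ (1 / s) := by
          rw [← ENNReal.ofReal_mul (by positivity), ← ENNReal.ofReal_mul (by positivity), htime]
      _ ≤ _ := by gcongr
  calc duhamelMap N θ γ p (volume.withDensity f) (fun q => c * U q ^ (1 / s)) (x, t)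
      ≤ C₀ * I ^ (1 - 1 / s) * U (x, t) ^ (1 / s) + 1 * U (x, t) ^ (1 / s) :=
        add_le_add hlin hnonlin
    _ = c * U (x, t) ^ (1 / s) := by rw [hc, add_mul]

/-- Jensen's inequality for the power means of `f` over `S`. -/
theorem setLIntegral_rpow_le_of_laverage_rpow_le {α : Type*} [MeasurableSpace α] {μ : Measure α}
    {S : Set α} (hS0 : μ S ≠ 0) (hSt : μ S ≠ ∞) {f : α → ℝ≥0∞} (hf : Measurable f) {s r : ℝ}
    (hs : 0 < s) (hsr : s ≤ r) {A : ℝ≥0∞} (h : (⨍⁻ y in S, f y ^ r ∂μ) ^ (1 / r) ≤ A) :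
    ∫⁻ y in S, f y ^ s ∂μ ≤ μ S * A ^ s := by
  set ν := (μ.restrict S univ)⁻¹ • μ.restrict S with hν
  have huniv : μ.restrict S univ = μ S := by simp
  have hν1 : ν univ = 1 := by
    rw [hν, Measure.smul_apply, smul_eq_mul, huniv, ENNReal.inv_mul_cancel hS0 hSt]
  have h1 := eLpNorm'_le_eLpNorm'_mul_rpow_measure_univ (μ := ν) hs hsr
    hf.aestronglyMeasurable
  rw [hν1, ENNReal.one_rpow, mul_one] at h1
  simp only [eLpNorm', enorm_eq_self] at h1
  have h2 : (∫⁻ y, f y ^ s ∂ν) ^ (1 / s) ≤ A := h1.trans h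
  have h3 : ∫⁻ y, f y ^ s ∂ν ≤ A ^ s := by
    have := ENNReal.rpow_le_rpow h2 hs.le
    rwa [← ENNReal.rpow_mul, one_div_mul_cancel hs.ne', ENNReal.rpow_one] at this
  rw [hν, lintegral_smul_measure, huniv, smul_eq_mul] at h3
  calc ∫⁻ y in S, f y ^ s ∂μ = μ S * ((μ S)⁻¹ * ∫⁻ y in S, f y ^ s ∂μ) := by
        rw [← mul_assoc, ENNReal.mul_inv_cancel hS0 hSt, one_mul]
    _ ≤ _ := by gcongr

end Supersolution

theorem theorem1p3 (N : ℕ) (hN : 1 ≤ N) (θ γ p : ℝ) (hθ : 0 < θ) (hθ2 : θ ≤ 2)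
    (hγ : 0 < γ) (hγmin : γ < min θ (N : ℝ)) (hγp : θ < 2 → γ < θ * (p - 1))
    (hp : 1 + (θ - γ) / N < p) :
    ∃ ε : ℝ, 0 < ε ∧
      ∀ r : ℝ, 1 < r → r ∈ Set.Ioo (N * (p - 1) / (θ - γ) - ε) (N * (p - 1) / (θ - γ)) →
        ∃ C₃ : ℝ, 0 < C₃ ∧
          ∀ (T : ℝ≥0∞), 0 < T →
            ∀ μ : EuclideanSpace ℝ (Fin N) → ℝ≥0∞, AEMeasurable μ volume →
              (∀ σ : ℝ, 0 < σ → ENNReal.ofReal σ < T ^ (1 / θ) →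
                (⨆ z : EuclideanSpace ℝ (Fin N),
                    (⨍⁻ y in Metric.ball z σ, μ y ^ r ∂volume) ^ (1 / r)) ≤
                  ENNReal.ofReal (C₃ * σ ^ (-((θ - γ) / (p - 1))))) →
              ∃ u : EuclideanSpace ℝ (Fin N) × ℝ → ℝ≥0∞,
                IsHardySolution N θ γ p (volume.withDensity μ) T u := by
  have hγθ : γ < θ := hγmin.trans_le (min_le_left _ _)
  have hγN : γ < N := hγmin.trans_le (min_le_right _ _)
  have hp1 : 1 < p := by
    have : 0 ≤ (θ - γ) / N := div_nonneg (by linarith) N.cast_nonneg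
    linarith
  -- the argument works for every `r > 1`, so that the value of `ε` does not matter
  refine ⟨1, one_pos, fun r hr _ => ?_⟩
  -- an exponent below both `r` and `p`: Jensen's inequality passes from `r` to `s`
  obtain ⟨s, hs1, hs⟩ : ∃ s, 1 < s ∧ s < min r p := exists_between (lt_min hr hp1)
  have hsr : s < r := hs.trans_le (min_le_left _ _)
  have hsp : s < p := hs.trans_le (min_le_right _ _)
  have hs0 : 0 < s := by linarith
  obtain ⟨c, D, hc, hD, B, hB, hmain⟩ :=
    exists_duhamelMap_heatPotential_le hN hθ hθ2 hγ hγθ hγN hs1 hsp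
  set C₃ : ℝ := (D.toReal + 1) ^ (-(1 / (p - 1))) with hC₃
  have hD0 : 0 < D.toReal + 1 := by positivity
  have hC₃0 : 0 < C₃ := by positivity
  have hsmall : D * ENNReal.ofReal (C₃ ^ (p - 1)) ≤ 1 := by
    have h1 : C₃ ^ (p - 1) = (D.toReal + 1)⁻¹ := by
      have : p - 1 ≠ 0 := by linarith
      rw [hC₃, ← Real.rpow_mul hD0.le, neg_mul, one_div_mul_cancel this, Real.rpow_neg_one]
    rw [h1, ← ENNReal.ofReal_toReal hD, ← ENNReal.ofReal_mul ENNReal.toReal_nonneg,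
      ENNReal.ofReal_le_one, ENNReal.toReal_ofReal ENNReal.toReal_nonneg, ← div_eq_mul_inv,
      div_le_one hD0]
    linarith
  refine ⟨C₃, hC₃0, fun T _ μ hμ hM => ?_⟩
  set f := hμ.mk μ with hf
  have hfm : Measurable f := hμ.measurable_mk
  have hμf : μ =ᵐ[volume] f := hμ.ae_eq_mk
  rw [withDensity_congr_ae hμf]
  have hball : ∀ t : ℝ, 0 < t → ENNReal.ofReal t < T → ∀ z : EuclideanSpace ℝ (Fin N),
      ∫⁻ y in Metric.ball z (t ^ (1 / θ)), f y ^ s ≤ volume (Metric.ball z (t ^ (1 / θ))) *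
        ENNReal.ofReal (C₃ * t ^ (-((θ - γ) / (p - 1) / θ))) ^ s := by
    intro t ht htT z
    have hσ : 0 < t ^ (1 / θ) := by positivity
    have hσT : ENNReal.ofReal (t ^ (1 / θ)) < T ^ (1 / θ) := by
      rw [← ENNReal.ofReal_rpow_of_pos ht]
      exact ENNReal.rpow_lt_rpow htT (by positivity)
    have h := (le_iSup _ z).trans (hM _ hσ hσT)
    rw [← Real.rpow_mul ht.le, show 1 / θ * -((θ - γ) / (p - 1)) = -((θ - γ) / (p - 1) / θ) by
      ring] at h
    refine setLIntegral_rpow_le_of_laverage_rpow_le (Metric.measure_ball_pos volume z hσ).ne'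
      measure_ball_lt_top.ne hfm hs0 hsr.le (le_trans (le_of_eq ?_) h)
    congr 1
    exact laverage_congr (ae_restrict_of_ae (hμf.symm.mono fun y hy => by simp only [hy]))
  have hkey := hmain C₃ hC₃0 hsmall T f hfm hball
  refine exists_isHardySolution_of_duhamelMap_le (by linarith) _ (fun q hq => ?_)
    fun q hq => (hkey q hq).2
  have hfin : heatPotential N θ s f q ≠ ∞ := ne_top_of_le_ne_top
    (ENNReal.mul_ne_top hB (ENNReal.rpow_ne_top_of_nonneg hs0.le ENNReal.ofReal_ne_top))
    (hkey q hq).1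
  exact (ENNReal.mul_ne_top hc (ENNReal.rpow_ne_top_of_nonneg (by positivity) hfin)).lt_top
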